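/- Let $\mathcal A$ be an abelian category with enough injectives, let $D^+(\mathcal A)$ be its bounded below derived category and let $D^+F(\mathcal A)$ be the bounded below filtered derived category for finite decreasing filtrations: the localization of the category of bounded below complexes $K$ of objects of $\mathcal A$ equipped with a decreasing filtration by subcomplexes $(\mathrm{Fil}^iK)_{i\in\mathbb Z}$ such that $\mathrm{Fil}^aK=K$ and $\mathrm{Fil}^bK=0$ for some $a,b\in\mathbb Z$, with respect to the filtered morphisms $f$ such that $\mathrm{Gr}^i f$ is a quasi-isomorphism for every $i\in\mathbb Z$. Put $\mathrm{Fil}^{-\infty}K=K$ and $\mathrm{Fil}^{+\infty}K=0$. The functors $K\mapsto \mathrm{Fil}^iK/\mathrm{Fil}^jK$ (for $-\infty\le i\le j\le+\infty$), in particular $\mathrm{Gr}^i=\mathrm{Fil}^i/\mathrm{Fil}^{i+1}$, and the forgetful functor $K\mapsto K$ induce functors $\mathrm{Fil}^i/\mathrm{Fil}^j$, $\mathrm{Gr}^i$ and $\omega\cong\mathrm{Fil}^{-\infty}/\mathrm{Fil}^{+\infty}$ from $D^+F(\mathcal A)$ to $D^+(\mathcal A)$. Let $\mathcal D\subset D^+(\mathcal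 A)$ be a full triangulated subcategory, let $(\mathcal D^{\le0},\mathcal D^{\ge0})$ be a t-structure on $\mathcal D$, let $\mathcal C=\mathcal D^{\le 0}\cap\mathcal D^{\ge 0}$ be its heart, and let $\mathcal DF\subset D^+F(\mathcal A)$ be the full subcategory of the objects $A$ such that $\mathrm{Gr}^iA\in\mathcal D$ for all $i\in\mathbb Z$ (membership of an object of $D^+(\mathcal A)$ in $\mathcal D$ or $\mathcal C$ is understood up to isomorphism). Then there is an equivalence of categories between the category of pairs $(X,\mathrm{Fil}^\bullet X)$, where $X\in\mathcal C$ and $\mathrm{Fil}^\bullet X$ is a finite decreasing filtration of $X$ by subobjects in $\mathcal C$ (morphisms being the morphisms of $\mathcal C$ that respect the filtrations), and the full subcategory of $\mathcal DF$ of the objects $A$ such that $\mathrm{Gr}^iA\in\mathcal C$ for all $i\in\mathbb Z$. If $A$ corresponds to $(X,\mathrm{Fil}^\bullet X)$ under this equivalence, there are isomorphisms $$(\mathrm{Fil}^i/\mathrm{Fil}^j)(A)\cong \mathrm{Fil}^iX/\mathrm{Fil}^jX\qquad(-\infty\le i\le j\le+\infty),$$ in particular $\mathrm{Gr}^iA\cong\mathrm{Gr}^iX$,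 and $\omega A\cong X$. They are natural in $(X,\mathrm{Fil}^\bullet X)$, compatible with the canonical maps $\mathrm{Fil}^{i'}/\mathrm{Fil}^{j'}\to\mathrm{Fil}^i/\mathrm{Fil}^j$ for $i\le i'$ and $j\le j'$, and compatible with the canonical isomorphisms $\omega\cong\mathrm{Fil}^{-\infty}/\mathrm{Fil}^{+\infty}$ and $X\cong \mathrm{Fil}^{-\infty}X/\mathrm{Fil}^{+\infty}X$. -/

import Mathlib

open CategoryTheory CategoryTheory.Limits

universe w v u

/-- An object of a category `C` endowed with a finite decreasing filtration by subobjects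
`⋯ ⊇ Fil^i ⊇ Fil^{i+1} ⊇ ⋯`, `i ∈ ℤ`. Finiteness says that `Fil^a` is the whole object for some
`a ∈ ℤ` and that `Fil^b` is zero for some `b ∈ ℤ`. The filtration is indexed by `[-∞, +∞]`
with the convention that `Fil^{-∞}` is the whole object and `Fil^{+∞}` is zero. -/
structure FilteredObject (C : Type u) [Category.{v} C] where
  /-- the underlying object -/
  obj : C
  /-- the filtration -/
  fil : EInt → Subobject obj
  antitone_fil : Antitone fil
  fil_bot : fil ⊥ = ⊤
  isZero_fil_top : IsZero (fil ⊤ : C)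
  exists_fil_eq_bot : ∃ a : ℤ, fil (a : EInt) = fil ⊥
  exists_fil_eq_top : ∃ b : ℤ, fil (b : EInt) = fil ⊤

namespace FilteredObject

section Basic

variable {C : Type u} [Category.{v} C]

/-- A morphism of filtered objects: a morphism of the underlying objects that sends
`Fil^i` into `Fil^i` for all `i`. -/
@[ext]
structure Hom (X Y : FilteredObject C) where
  /-- the underlying morphism -/
  hom : X.obj ⟶ Y.obj
  factors : ∀ i, (Y.fil i).Factors ((X.fil i).arrow ≫ hom)

lemma factors_comp {X Y Z : FilteredObject C} (f : X.Hom Y) (g : Y.Hom Z) (i : EInt) :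
    (Z.fil i).Factors ((X.fil i).arrow ≫ f.hom ≫ g.hom) := by
  have h : (X.fil i).arrow ≫ f.hom ≫ g.hom =
      ((Y.fil i).factorThru _ (f.factors i) ≫ (Z.fil i).factorThru _ (g.factors i)) ≫
        (Z.fil i).arrow := by simp
  rw [h]
  exact Subobject.factors_comp_arrow _

instance : Category (FilteredObject C) where
  Hom := Hom
  id X := ⟨𝟙 X.obj, fun i => by simpa using Subobject.factors_self (X.fil i)⟩
  comp f g := ⟨f.hom ≫ g.hom, factors_comp f g⟩
  id_comp f := Hom.ext (Category.id_comp _)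
  comp_id f := Hom.ext (Category.comp_id _)
  assoc f g h := Hom.ext (Category.assoc _ _ _)

@[simp]
lemma id_hom (X : FilteredObject C) : Hom.hom (𝟙 X) = 𝟙 X.obj := rfl

@[simp]
lemma comp_hom {X Y Z : FilteredObject C} (f : X ⟶ Y) (g : Y ⟶ Z) :
    Hom.hom (f ≫ g) = f.hom ≫ g.hom := rfl

variable (C) in
/-- The functor which forgets the filtration. -/
def forget : FilteredObject C ⥤ C where
  obj X := X.obj
  map f := f.hom

/-- The inclusion `Fil^j X ⟶ Fil^i X` for `i ≤ j`. -/
noncomputable def incl (X : FilteredObject C) {i j : EInt} (h : i ≤ j) :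
    (X.fil j : C) ⟶ (X.fil i : C) :=
  Subobject.ofLE _ _ (X.antitone_fil h)

/-- The morphism `Fil^i X ⟶ Fil^i Y` induced by a morphism of filtered objects. -/
noncomputable def filMap {X Y : FilteredObject C} (f : X ⟶ Y) (i : EInt) :
    (X.fil i : C) ⟶ (Y.fil i : C) :=
  (Y.fil i).factorThru ((X.fil i).arrow ≫ f.hom) (f.factors i)

@[simp]
lemma filMap_arrow {X Y : FilteredObject C} (f : X ⟶ Y) (i : EInt) :
    filMap f i ≫ (Y.fil i).arrow = (X.fil i).arrow ≫ f.hom := by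
  simp [filMap]

@[simp]
lemma incl_arrow (X : FilteredObject C) {i j : EInt} (h : i ≤ j) :
    X.incl h ≫ (X.fil i).arrow = (X.fil j).arrow := by
  simp [incl]

instance (X : FilteredObject C) {i j : EInt} (h : i ≤ j) : Mono (X.incl h) := by
  dsimp [incl]; infer_instance

@[simp]
lemma filMap_id (X : FilteredObject C) (i : EInt) : filMap (𝟙 X) i = 𝟙 _ := by
  simp [← cancel_mono (X.fil i).arrow]

lemma filMap_comp {X Y Z : FilteredObject C} (f : X ⟶ Y) (g : Y ⟶ Z) (i : EInt) :
    filMap (f ≫ g) i = filMap f i ≫ filMap g i := by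
  simp only [← cancel_mono (Z.fil i).arrow, filMap_arrow, Category.assoc, comp_hom]
  rw [← Category.assoc, ← filMap_arrow, Category.assoc]

lemma incl_filMap {X Y : FilteredObject C} (f : X ⟶ Y) {i j : EInt} (h : i ≤ j) :
    X.incl h ≫ filMap f i = filMap f j ≫ Y.incl h := by
  rw [← cancel_mono (Y.fil i).arrow, Category.assoc, Category.assoc, filMap_arrow, incl_arrow,
    filMap_arrow, ← Category.assoc, incl_arrow]

lemma incl_comp_incl (X : FilteredObject C) {i j k : EInt} (h : i ≤ j) (h' : j ≤ k) :
    X.incl h' ≫ X.incl h = X.incl (h.trans h') := by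
  rw [← cancel_mono (X.fil i).arrow, Category.assoc, incl_arrow, incl_arrow, incl_arrow]

lemma isIso_incl (X : FilteredObject C) {i j : EInt} (h : i ≤ j) (e : X.fil i = X.fil j) :
    IsIso (X.incl h) :=
  ⟨Subobject.ofLE _ _ e.le, by simp [incl, Subobject.ofLE_comp_ofLE],
    by simp [incl, Subobject.ofLE_comp_ofLE]⟩

lemma isIso_fil_bot_arrow (X : FilteredObject C) : IsIso (X.fil ⊥).arrow :=
  (Subobject.isIso_arrow_iff_eq_top _).2 X.fil_bot

/-- The canonical isomorphism `Fil^{-∞} X ≅ X`. -/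
noncomputable def filBotIso (X : FilteredObject C) : (X.fil ⊥ : C) ≅ X.obj :=
  have := X.isIso_fil_bot_arrow
  asIso (X.fil ⊥).arrow

@[simp]
lemma filBotIso_hom (X : FilteredObject C) : X.filBotIso.hom = (X.fil ⊥).arrow := rfl

end Basic

section Quot

variable {C : Type u} [Category.{v} C] [HasZeroMorphisms C] [HasCokernels C]

/-- The functor `Fil^i/Fil^j` for `i ≤ j` in `[-∞, +∞]`. -/
noncomputable def quot (i j : EInt) (h : i ≤ j) : FilteredObject C ⥤ C where
  obj X := cokernel (X.incl h)
  map f := cokernel.map _ _ (filMap f j) (filMap f i) (incl_filMap f h)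
  map_id X := by simp
  map_comp {X _ _} f g := by simp [← cancel_epi (cokernel.π (X.incl h)), filMap_comp]

/-- The projection `Fil^i X ⟶ Fil^i X/Fil^j X`. -/
noncomputable def proj (X : FilteredObject C) {i j : EInt} (h : i ≤ j) :
    (X.fil i : C) ⟶ (quot i j h).obj X :=
  cokernel.π (X.incl h)

instance (X : FilteredObject C) {i j : EInt} (h : i ≤ j) : Epi (X.proj h) :=
  inferInstanceAs (Epi (cokernel.π (X.incl h)))

lemma proj_quot_map {X Y : FilteredObject C} (f : X ⟶ Y) {i j : EInt} (h : i ≤ j) :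
    X.proj h ≫ (quot i j h).map f = filMap f i ≫ Y.proj h :=
  cokernel.π_desc _ _ _

/-- The map `Fil^{i'} X/Fil^{j'} X ⟶ Fil^i X/Fil^j X` for `i ≤ i'` and `j ≤ j'`. -/
noncomputable def quotMapApp (X : FilteredObject C) {i j i' j' : EInt} (h : i ≤ j) (h' : i' ≤ j')
    (hi : i ≤ i') (hj : j ≤ j') : (quot i' j' h').obj X ⟶ (quot i j h).obj X :=
  cokernel.map _ _ (X.incl hj) (X.incl hi) (by simp only [incl_comp_incl])

lemma proj_quotMapApp (X : FilteredObject C) {i j i' j' : EInt} (h : i ≤ j) (h' : i' ≤ j')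
    (hi : i ≤ i') (hj : j ≤ j') :
    X.proj h' ≫ X.quotMapApp h h' hi hj = X.incl hi ≫ X.proj h :=
  cokernel.π_desc _ _ _

/-- The natural transformation `Fil^{i'}/Fil^{j'} ⟶ Fil^i/Fil^j` for `i ≤ i'` and `j ≤ j'`,
induced by the inclusions `Fil^{i'} ⊆ Fil^i` and `Fil^{j'} ⊆ Fil^j`. -/
noncomputable def quotMap {i j i' j' : EInt} (h : i ≤ j) (h' : i' ≤ j')
    (hi : i ≤ i') (hj : j ≤ j') : quot (C := C) i' j' h' ⟶ quot i j h where
  app X := X.quotMapApp h h' hi hj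
  naturality X Y f := by
    rw [← cancel_epi (X.proj h'), ← Category.assoc, proj_quot_map, Category.assoc,
      proj_quotMapApp, ← Category.assoc (X.proj h'), proj_quotMapApp, Category.assoc,
      proj_quot_map, ← Category.assoc, ← Category.assoc, incl_filMap]

/-- The canonical natural transformation `X ⟶ Fil^{-∞} X/Fil^{+∞} X`. -/
noncomputable def toQuot : forget C ⟶ quot (C := C) ⊥ ⊤ bot_le where
  app X := X.filBotIso.inv ≫ X.proj bot_le
  naturality X Y f := by
    dsimp only [forget]
    rw [Category.assoc, proj_quot_map, ← Category.assoc, ← Category.assoc]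
    congr 1
    rw [Iso.eq_inv_comp, ← Category.assoc, Iso.comp_inv_eq, filBotIso_hom, filBotIso_hom,
      filMap_arrow]

/-- The functor `Gr^i = Fil^i/Fil^{i+1}`. -/
noncomputable abbrev gr (i : ℤ) : FilteredObject C ⥤ C :=
  quot (i : EInt) ((i + 1 : ℤ) : EInt) (WithBotTop.coe_le_coe.2 (by lia))

instance : IsIso (toQuot (C := C)) := by
  have (X : FilteredObject C) : IsIso ((toQuot (C := C)).app X) := by
    have : IsIso (X.proj (bot_le : (⊥ : EInt) ≤ ⊤)) :=
      cokernel.π_of_zero (X.isZero_fil_top.eq_of_src _ _)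
    exact IsIso.comp_isIso' (Iso.isIso_inv X.filBotIso) this
  exact NatIso.isIso_of_isIso_app _

lemma isIso_quotMap_app (X : FilteredObject C) {i j i' j' : EInt} (h : i ≤ j) (h' : i' ≤ j')
    (hi : i ≤ i') (hj : j ≤ j') (ei : X.fil i = X.fil i') (ej : X.fil j = X.fil j') :
    IsIso ((quotMap h h' hi hj).app X) := by
  have := X.isIso_incl hi ei
  have := X.isIso_incl hj ej
  exact (cokernel.mapIso _ _ (asIso (X.incl hj)) (asIso (X.incl hi))
    (by simp only [asIso_hom, incl_comp_incl])).isIso_hom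

lemma isZero_quot_self (X : FilteredObject C) (i : EInt) :
    IsZero ((quot i i le_rfl).obj X) := by
  have := X.isIso_incl (le_refl i) rfl
  exact isZero_cokernel_of_epi _

/-- For `i ≤ j ≤ k`, the sequence `Fil^j/Fil^k ⟶ Fil^i/Fil^k ⟶ Fil^i/Fil^j`. -/
noncomputable def quotSequence {i j k : EInt} (h : i ≤ j) (h' : j ≤ k) (X : FilteredObject C) :
    ShortComplex C where
  X₁ := (quot j k h').obj X
  X₂ := (quot i k (h.trans h')).obj X
  X₃ := (quot i j h).obj X
  f := (quotMap (h.trans h') h' h le_rfl).app X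
  g := (quotMap h (h.trans h') le_rfl h').app X
  zero := by
    rw [← cancel_epi (X.proj h')]
    change X.proj h' ≫ X.quotMapApp (h.trans h') h' h le_rfl ≫
      X.quotMapApp h (h.trans h') le_rfl h' = _
    rw [← Category.assoc, proj_quotMapApp, Category.assoc, proj_quotMapApp, ← Category.assoc,
      incl_comp_incl, comp_zero]
    exact cokernel.condition _

/-- The morphism of sequences induced by a morphism of filtered objects. -/
noncomputable def quotSequenceMap {i j k : EInt} (h : i ≤ j) (h' : j ≤ k) {X Y : FilteredObject C}
    (f : X ⟶ Y) : X.quotSequence h h' ⟶ Y.quotSequence h h' where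
  τ₁ := (quot j k h').map f
  τ₂ := (quot i k (h.trans h')).map f
  τ₃ := (quot i j h).map f
  comm₁₂ := (quotMap (h.trans h') h' h le_rfl).naturality f
  comm₂₃ := (quotMap h (h.trans h') le_rfl h').naturality f

end Quot

end FilteredObject

section Homology

variable {A : Type u} [Category.{v} A] [Abelian A]

open HomologicalComplex HomologicalComplex.HomologySequence in
lemma quasiIso_τ₂_of_shortExact {S₁ S₂ : ShortComplex (CochainComplex A ℤ)} (φ : S₁ ⟶ S₂)
    (hS₁ : S₁.ShortExact) (hS₂ : S₂.ShortExact) (h₁ : QuasiIso φ.τ₁) (h₃ : QuasiIso φ.τ₃) :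
    QuasiIso φ.τ₂ := by
  rw [quasiIso_iff]
  intro i
  rw [quasiIsoAt_iff_isIso_homologyMap]
  have hm : Mono (homologyMap φ.τ₂ i) := by
    have hij : (ComplexShape.up ℤ).Rel (i - 1) i := by simp
    apply Abelian.mono_of_epi_of_mono_of_mono ((ComposableArrows.δ₀Functor ⋙
      ComposableArrows.δ₀Functor).map (mapComposableArrows₅ φ hS₁ hS₂ (i - 1) i hij))
    · exact (composableArrows₅_exact hS₁ (i - 1) i hij).δ₀.δ₀
    · exact (composableArrows₅_exact hS₂ (i - 1) i hij).δ₀.δ₀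
    · exact inferInstanceAs (Epi (homologyMap φ.τ₃ (i - 1)))
    · exact inferInstanceAs (Mono (homologyMap φ.τ₁ i))
    · exact inferInstanceAs (Mono (homologyMap φ.τ₃ i))
  have he : Epi (homologyMap φ.τ₂ i) := by
    have hij : (ComplexShape.up ℤ).Rel i (i + 1) := by simp
    apply Abelian.epi_of_epi_of_epi_of_mono ((ComposableArrows.δlastFunctor ⋙
      ComposableArrows.δlastFunctor).map (mapComposableArrows₅ φ hS₁ hS₂ i (i + 1) hij))
    · exact (composableArrows₅_exact hS₁ i (i + 1) hij).δlast.δlast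
    · exact (composableArrows₅_exact hS₂ i (i + 1) hij).δlast.δlast
    · exact inferInstanceAs (Epi (homologyMap φ.τ₁ i))
    · exact inferInstanceAs (Epi (homologyMap φ.τ₃ i))
    · exact inferInstanceAs (Mono (homologyMap φ.τ₁ (i + 1)))
  exact isIso_of_mono_of_epi _

/-- In an abelian category, for composable monomorphisms `f`, `g`, the sequence
`0 ⟶ coker f ⟶ coker (f ≫ g) ⟶ coker g ⟶ 0` is short exact. -/
lemma shortExact_of_isColimit {X Y Z : A} (f : X ⟶ Y) (g : Y ⟶ Z) (fg : X ⟶ Z)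
    (hfg : f ≫ g = fg) [Mono g]
    (S : ShortComplex A) (p : Y ⟶ S.X₁) (q : Z ⟶ S.X₂) (r : Z ⟶ S.X₃)
    (hp : f ≫ p = 0) (hq : fg ≫ q = 0) (hr : g ≫ r = 0)
    (cp : IsColimit (CokernelCofork.ofπ p hp)) (cq : IsColimit (CokernelCofork.ofπ q hq))
    (cr : IsColimit (CokernelCofork.ofπ r hr))
    (h₁ : p ≫ S.f = g ≫ q) (h₂ : q ≫ S.g = r) : S.ShortExact := by
  have : Epi p := epi_of_isColimit_cofork cp
  have : Epi q := epi_of_isColimit_cofork cq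
  have : Epi r := epi_of_isColimit_cofork cr
  have ex₁ : (ShortComplex.mk f p hp).Exact := ShortComplex.exact_of_g_is_cokernel _ cp
  have ex₂ : (ShortComplex.mk fg q hq).Exact := ShortComplex.exact_of_g_is_cokernel _ cq
  have ex₃ : (ShortComplex.mk g r hr).Exact := ShortComplex.exact_of_g_is_cokernel _ cr
  refine { exact := ?_, mono_f := ?_, epi_g := ?_ }
  · rw [ShortComplex.exact_iff_exact_up_to_refinements]
    intro T x hx
    obtain ⟨T₁, π₁, _, z, hz⟩ := surjective_up_to_refinements_of_epi q x
    obtain ⟨T₂, π₂, _, y, hy⟩ := ex₃.exact_up_to_refinements z (by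
      change z ≫ r = 0
      have : z ≫ q ≫ S.g = 0 := by
        rw [← Category.assoc, ← hz, Category.assoc, hx, comp_zero]
      rwa [h₂] at this)
    dsimp at hy
    refine ⟨T₂, π₂ ≫ π₁, inferInstance, y ≫ p, ?_⟩
    rw [Category.assoc, hz, ← Category.assoc, hy, Category.assoc, Category.assoc, h₁]
  · refine Preadditive.mono_of_cancel_zero _ (fun {T} x hx => ?_)
    obtain ⟨T₁, π₁, _, y, hy⟩ := surjective_up_to_refinements_of_epi p x
    obtain ⟨T₂, π₂, _, w, hw⟩ := ex₂.exact_up_to_refinements (y ≫ g) (by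
      dsimp
      rw [Category.assoc, ← h₁, ← Category.assoc, ← hy, Category.assoc, hx, comp_zero])
    dsimp at hw
    have hw' : π₂ ≫ y = w ≫ f := by
      rw [← cancel_mono g, Category.assoc, hw, Category.assoc, hfg]
    rw [← cancel_epi π₁, ← cancel_epi π₂, hy, ← Category.assoc, hw', Category.assoc, hp]
    simp
  · exact epi_of_epi_fac h₂

lemma quotSequence_shortExact {i j k : EInt} (h : i ≤ j) (h' : j ≤ k)
    (X : FilteredObject (CochainComplex.Plus A)) :
    ((X.quotSequence h h').map (CochainComplex.Plus.ι A)).ShortExact := by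
  let F := CochainComplex.Plus.ι A
  have hc {Y Z : CochainComplex.Plus A} (a : Y ⟶ Z) : IsColimit (CokernelCofork.ofπ
      (F.map (cokernel.π a)) (by rw [← F.map_comp, cokernel.condition, F.map_zero])) :=
    isColimitOfHasCokernelOfPreservesColimit F a
  have hfg : F.map (X.incl h') ≫ F.map (X.incl h) = F.map (X.incl (h.trans h')) := by
    rw [← F.map_comp, FilteredObject.incl_comp_incl]
  have : Mono (F.map (X.incl h)) := inferInstance
  have hz {i j : EInt} (h : i ≤ j) : F.map (X.incl h) ≫ F.map (X.proj h) = 0 := by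
    rw [← F.map_comp]
    exact (F.congr_map (cokernel.condition (X.incl h))).trans (F.map_zero _ _)
  refine shortExact_of_isColimit (F.map (X.incl h')) (F.map (X.incl h)) _ hfg _
    (F.map (X.proj h')) (F.map (X.proj (h.trans h'))) (F.map (X.proj h)) (hz h')
    (hz (h.trans h')) (hz h) (hc (X.incl h')) (hc (X.incl (h.trans h'))) (hc (X.incl h)) ?_ ?_
  · exact (F.map_comp _ _).symm.trans ((F.congr_map
      (X.proj_quotMapApp (h.trans h') h' h le_rfl)).trans (F.map_comp _ _))
  · refine (F.map_comp _ _).symm.trans (F.congr_map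
      ((X.proj_quotMapApp h (h.trans h') le_rfl h').trans ?_))
    simp [FilteredObject.incl]

end Homology

namespace FilteredDerivedCategory

variable (A : Type u) [Category.{v} A] [Abelian A]

/-- The filtered quasi-isomorphisms between bounded below complexes (of objects of `A`) equipped
with a finite decreasing filtration by subcomplexes: these are the morphisms `f` such that
`Gr^i f` is a quasi-isomorphism for all `i ∈ ℤ`. -/
def quasiIso : MorphismProperty (FilteredObject (CochainComplex.Plus A)) :=
  fun _ _ f => ∀ i : ℤ, CochainComplex.Plus.quasiIso A ((FilteredObject.gr i).map f)

/-- The bounded below filtered derived category `D⁺F(A)`: the localization of the category of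
bounded below complexes with a finite decreasing filtration with respect to
filtered quasi-isomorphisms. -/
abbrev Plus : Type (max u v) := (quasiIso A).Localization

variable {A}

lemma quasiIso_quot_map {K L : FilteredObject (CochainComplex.Plus A)} (f : K ⟶ L)
    (hf : quasiIso A f) (i j : EInt) (h : i ≤ j) :
    CochainComplex.Plus.quasiIso A ((FilteredObject.quot i j h).map f) := by
  -- comparison of two pairs of indices where the filtrations agree
  have key {i j i' j' : EInt} (h : i ≤ j) (h' : i' ≤ j') (hi : i ≤ i') (hj : j ≤ j')
      (ei : K.fil i = K.fil i') (ej : K.fil j = K.fil j')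
      (ei' : L.fil i = L.fil i') (ej' : L.fil j = L.fil j') :
      CochainComplex.Plus.quasiIso A ((FilteredObject.quot i j h).map f) ↔
        CochainComplex.Plus.quasiIso A ((FilteredObject.quot i' j' h').map f) := by
    exact ((CochainComplex.Plus.quasiIso A).arrow_mk_iso_iff (Arrow.isoMk
      (@asIso _ _ _ _ ((FilteredObject.quotMap h h' hi hj).app K)
        (FilteredObject.isIso_quotMap_app K h h' hi hj ei ej))
      (@asIso _ _ _ _ ((FilteredObject.quotMap h h' hi hj).app L)
        (FilteredObject.isIso_quotMap_app L h h' hi hj ei' ej'))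
      ((FilteredObject.quotMap h h' hi hj).naturality f).symm)).symm
  have hself (i : EInt) : CochainComplex.Plus.quasiIso A
      ((FilteredObject.quot i i le_rfl).map f) := by
    have : IsIso ((FilteredObject.quot i i le_rfl).map f) :=
      ⟨0, (K.isZero_quot_self i).eq_of_src _ _, (L.isZero_quot_self i).eq_of_src _ _⟩
    exact inferInstanceAs (QuasiIso ((CochainComplex.Plus.ι A).map
      ((FilteredObject.quot i i le_rfl).map f)))
  -- the case of finite indices, by dévissage
  have hfin (n : ℕ) : ∀ (i j : ℤ) (_ : j = i + n) (h : (i : EInt) ≤ (j : EInt)),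
      CochainComplex.Plus.quasiIso A ((FilteredObject.quot (i : EInt) (j : EInt) h).map f) := by
    induction n with
    | zero =>
      intro i j hj h
      obtain rfl : j = i := by simpa using hj
      exact hself _
    | succ n hn =>
      intro i j hj h
      obtain rfl : j = i + n + 1 := by rw [hj]; push_cast; ring
      have h₁ : (i : EInt) ≤ ((i + n : ℤ) : EInt) := WithBotTop.coe_le_coe.2 (by lia)
      have h₂ : ((i + n : ℤ) : EInt) ≤ ((i + n + 1 : ℤ) : EInt) :=
        WithBotTop.coe_le_coe.2 (by lia)
      exact quasiIso_τ₂_of_shortExact ((CochainComplex.Plus.ι A).mapShortComplex.map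
        (FilteredObject.quotSequenceMap h₁ h₂ f)) (quotSequence_shortExact h₁ h₂ K)
        (quotSequence_shortExact h₁ h₂ L) (hf (i + n)) (hn _ _ rfl h₁)
  have hfin' (i j : ℤ) (h : (i : EInt) ≤ (j : EInt)) : CochainComplex.Plus.quasiIso A
      ((FilteredObject.quot (i : EInt) (j : EInt) h).map f) := by
    obtain ⟨n, rfl⟩ := Int.le.dest (WithBotTop.coe_le_coe.1 h)
    exact hfin n _ _ rfl _
  -- common bounds for the two filtrations
  have hbot (X : FilteredObject (CochainComplex.Plus A)) {a b : ℤ} (h : a ≤ b)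
      (hb : X.fil (b : EInt) = X.fil ⊥) : X.fil (a : EInt) = X.fil ⊥ :=
    le_antisymm (X.antitone_fil bot_le)
      (hb.ge.trans (X.antitone_fil (WithBotTop.coe_le_coe.2 h)))
  have htop (X : FilteredObject (CochainComplex.Plus A)) {a b : ℤ} (h : a ≤ b)
      (ha : X.fil (a : EInt) = X.fil ⊤) : X.fil (b : EInt) = X.fil ⊤ :=
    le_antisymm ((X.antitone_fil (WithBotTop.coe_le_coe.2 h)).trans ha.le)
      (X.antitone_fil le_top)
  obtain ⟨a₁, ha₁⟩ := K.exists_fil_eq_bot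
  obtain ⟨a₂, ha₂⟩ := L.exists_fil_eq_bot
  obtain ⟨b₁, hb₁⟩ := K.exists_fil_eq_top
  obtain ⟨b₂, hb₂⟩ := L.exists_fil_eq_top
  have hfinite_top (i : ℤ) : CochainComplex.Plus.quasiIso A
      ((FilteredObject.quot (i : EInt) ⊤ le_top).map f) := by
    have hib : (i : EInt) ≤ ((max i (max b₁ b₂) : ℤ) : EInt) :=
      WithBotTop.coe_le_coe.2 (by lia)
    exact (key hib le_top le_rfl le_top rfl (htop K (by lia) hb₁) rfl
      (htop L (by lia) hb₂)).1 (hfin' _ _ _)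
  induction i using WithBotTop.rec with
  | bot =>
    induction j using WithBotTop.rec with
    | bot => exact hself _
    | coe j =>
      have hj : ((min j (min a₁ a₂) : ℤ) : EInt) ≤ (j : EInt) := WithBotTop.coe_le_coe.2 (by lia)
      exact (key bot_le hj bot_le le_rfl (hbot K (by lia) ha₁).symm rfl
        (hbot L (by lia) ha₂).symm rfl).2 (hfin' _ _ _)
    | top =>
      exact (key bot_le le_top bot_le le_rfl (hbot K (min_le_left a₁ a₂) ha₁).symm rfl
        (hbot L (min_le_right a₁ a₂) ha₂).symm rfl).2 (hfinite_top _)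
  | coe i =>
    induction j using WithBotTop.rec with
    | bot => exact absurd (le_bot_iff.1 h) (WithBotTop.coe_ne_bot i)
    | coe j => exact hfin' i j h
    | top => exact hfinite_top i
  | top =>
    obtain rfl : j = ⊤ := top_le_iff.1 h
    exact hself _

variable [HasDerivedCategory.{w} A]

lemma isIso_Q_map {K L : CochainComplex.Plus A} (f : K ⟶ L)
    (hf : CochainComplex.Plus.quasiIso A f) : IsIso (DerivedCategory.Plus.Q.map f) := by
  have hf' : QuasiIso ((CochainComplex.Plus.ι A).map f) := hf
  have : IsIso (DerivedCategory.Plus.ι.map (DerivedCategory.Plus.Q.map f)) :=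
    inferInstanceAs (IsIso (DerivedCategory.Q.map ((CochainComplex.Plus.ι A).map f)))
  exact isIso_of_fully_faithful DerivedCategory.Plus.ι _

lemma isInvertedBy_quot (i j : EInt) (h : i ≤ j) : (quasiIso A).IsInvertedBy
    (FilteredObject.quot i j h ⋙ DerivedCategory.Plus.Q) :=
  fun _ _ f hf => isIso_Q_map _ (quasiIso_quot_map f hf i j h)

lemma isInvertedBy_forget : (quasiIso A).IsInvertedBy
    (FilteredObject.forget _ ⋙ DerivedCategory.Plus.Q) := fun _ _ f hf =>
  (NatIso.isIso_map_iff (Functor.isoWhiskerRight (asIso FilteredObject.toQuot)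
    DerivedCategory.Plus.Q) f).2 (isInvertedBy_quot ⊥ ⊤ bot_le f hf)

/-- The functor `Fil^i/Fil^j : D⁺F(A) ⥤ D⁺(A)` for `i ≤ j` in `[-∞, +∞]`. -/
noncomputable def quot (i j : EInt) (h : i ≤ j) : Plus A ⥤ DerivedCategory.Plus A :=
  Localization.lift (FilteredObject.quot i j h ⋙ DerivedCategory.Plus.Q) (isInvertedBy_quot i j h)
    (quasiIso A).Q

noncomputable instance (i j : EInt) (h : i ≤ j) : Localization.Lifting (quasiIso A).Q (quasiIso A)
    (FilteredObject.quot i j h ⋙ DerivedCategory.Plus.Q) (quot i j h) :=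
  Localization.liftingLift _ _ _

/-- The natural transformation `Fil^{i'}/Fil^{j'} ⟶ Fil^i/Fil^j` of functors `D⁺F(A) ⥤ D⁺(A)`
for `i ≤ i'` and `j ≤ j'`, induced by the inclusions of the filtration. -/
noncomputable def quotMap {i j i' j' : EInt} (h : i ≤ j) (h' : i' ≤ j')
    (hi : i ≤ i') (hj : j ≤ j') : quot (A := A) i' j' h' ⟶ quot i j h :=
  Localization.liftNatTrans (quasiIso A).Q (quasiIso A) _ _ _ _
    (Functor.whiskerRight (FilteredObject.quotMap h h' hi hj) DerivedCategory.Plus.Q)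

/-- The functor `Gr^i : D⁺F(A) ⥤ D⁺(A)`. -/
noncomputable abbrev gr (i : ℤ) : Plus A ⥤ DerivedCategory.Plus A :=
  quot (i : EInt) ((i + 1 : ℤ) : EInt) (WithBotTop.coe_le_coe.2 (by lia))

variable (A) in
/-- The functor `ω : D⁺F(A) ⥤ D⁺(A)` which forgets the filtration. -/
noncomputable def omega : Plus A ⥤ DerivedCategory.Plus A :=
  Localization.lift (FilteredObject.forget _ ⋙ DerivedCategory.Plus.Q) isInvertedBy_forget
    (quasiIso A).Q

noncomputable instance : Localization.Lifting (quasiIso A).Q (quasiIso A)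
    (FilteredObject.forget _ ⋙ DerivedCategory.Plus.Q) (omega A) :=
  Localization.liftingLift _ _ _

/-- The canonical natural transformation `ω ⟶ Fil^{-∞}/Fil^{+∞}`, induced by the canonical maps
`K ⟶ Fil^{-∞} K/Fil^{+∞} K` for filtered complexes `K`. -/
noncomputable def omegaToQuot : omega A ⟶ quot ⊥ ⊤ bot_le :=
  Localization.liftNatTrans (quasiIso A).Q (quasiIso A) _ _ _ _
    (Functor.whiskerRight FilteredObject.toQuot DerivedCategory.Plus.Q)

section Subcategory

variable (P : ObjectProperty (DerivedCategory.Plus A))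

/-- The objects `K` of `D⁺F(A)` such that `Gr^i K` is (isomorphic to an object) in the
subcategory `𝒟` of `D⁺(A)` given by `P`, for all `i ∈ ℤ`. These are the objects of the category
usually denoted `𝒟F`. -/
def grMem : ObjectProperty (Plus A) :=
  fun K => ∀ i : ℤ, P.isoClosure ((gr i).obj K)

variable [P.IsTriangulated] (t : Triangulated.TStructure P.FullSubcategory)

/-- The inclusion in `D⁺(A)` of the heart of a t-structure on a triangulated
subcategory of `D⁺(A)`. -/
noncomputable abbrev heartι : t.heart.FullSubcategory ⥤ DerivedCategory.Plus A := t.heart.ι ⋙ P.ι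

/-- The objects `K` of `𝒟F` such that, for all `i ∈ ℤ`, `Gr^i K` is (isomorphic to an object)
in the heart of `t`. -/
def grMemHeart : ObjectProperty (Plus A) :=
  fun K => grMem P K ∧ ∀ i : ℤ, (heartι P t).essImage ((gr i).obj K)

end Subcategory

end FilteredDerivedCategory

section Heart

open Triangulated Pretriangulated

variable {C : Type u} [Category.{v} C] [Preadditive C] [HasZeroObject C] [HasShift C ℤ]
  [∀ n : ℤ, (shiftFunctor C n).Additive] [Pretriangulated C]

lemma admissibleMorphism_heart (t : TStructure C) {X₁ X₂ : t.heart.FullSubcategory}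
    (f : X₁ ⟶ X₂) : AbelianSubcategory.admissibleMorphism t.heart.ι f := by
  intro X₃ f₂ f₃ hT
  have h₁ := (t.mem_heart_iff _).1 X₁.property
  have h₂ := (t.mem_heart_iff _).1 X₂.property
  have hl₁ : t.IsLE X₁.obj 0 := h₁.1
  have hg₁ : t.IsGE X₁.obj 0 := h₁.2
  have hg₂ : t.IsGE X₂.obj 0 := h₂.2
  have hT' := rot_of_distTriang _ hT
  have hs₁ : t.IsLE (X₁.obj⟦(1 : ℤ)⟧) (-1) := t.isLE_shift X₁.obj 0 1 (-1)
  have hs₂ : t.IsGE (X₁.obj⟦(1 : ℤ)⟧) (-1) := t.isGE_shift X₁.obj 0 1 (-1)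
  have hle : t.IsLE X₃ 0 := t.isLE₂ _ hT' 0 h₂.1 (t.isLE_of_le (X₁.obj⟦(1 : ℤ)⟧) (-1) 0)
  have hge : t.IsGE X₃ (-1) := t.isGE₂ _ hT' (-1) (t.isGE_of_ge X₂.obj (-1) 0) hs₂
  obtain ⟨K, Q, hK, hQ, α, β, γ, hT''⟩ := t.exists_triangle X₃ (-1) 0 (by lia)
  have hK₁ : t.IsLE K (-1) := ⟨hK⟩
  have hQ₁ : t.IsGE Q 0 := ⟨hQ⟩
  have hK₂ : t.IsGE K (-1) := by
    have := t.isGE_shift Q 0 (-1) 1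
    exact t.isGE₂ _ (inv_rot_of_distTriang _ hT'') (-1)
      (t.isGE_of_ge (Q⟦(-1 : ℤ)⟧) (-1) 1) hge
  have hQ₂ : t.IsLE Q 0 := by
    have := t.isLE_shift K (-1) 1 (-2)
    exact t.isLE₂ _ (rot_of_distTriang _ hT'') 0 hle (t.isLE_of_le (K⟦(1 : ℤ)⟧) (-2) 0)
  have hK' : t.heart (K⟦(-1 : ℤ)⟧) :=
    (t.mem_heart_iff _).2 ⟨t.isLE_shift K (-1) (-1) 0, t.isGE_shift K (-1) (-1) 0⟩
  let e : K⟦(-1 : ℤ)⟧⟦(1 : ℤ)⟧ ≅ K := (shiftEquiv C (1 : ℤ)).counitIso.app K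
  refine ⟨⟨_, hK'⟩, ⟨Q, (t.mem_heart_iff _).2 ⟨hQ₂, hQ₁⟩⟩, e.hom ≫ α, β,
    γ ≫ e.inv⟦(1 : ℤ)⟧', ?_⟩
  refine isomorphic_distinguished _ hT'' _ ?_
  refine Triangle.isoMk _ _ e (Iso.refl _) (Iso.refl _) ?_ ?_ ?_
  · exact Category.comp_id _
  · exact (Category.comp_id _).trans (Category.id_comp _).symm
  · change (γ ≫ e.inv⟦(1 : ℤ)⟧') ≫ e.hom⟦(1 : ℤ)⟧' = 𝟙 _ ≫ γ
    rw [Category.assoc, ← Functor.map_comp, Iso.inv_hom_id, CategoryTheory.Functor.map_id, Category.comp_id,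
      Category.id_comp]

/-- The heart of a t-structure has cokernels (it is even an abelian category). -/
instance hasCokernels_heart (t : TStructure C) : HasCokernels t.heart.FullSubcategory where
  has_colimit f := AbelianSubcategory.hasCokernel_of_admissibleMorphism (ι := t.heart.ι)
    (fun X Y n f hn => by
      have hX : t.IsLE X.obj 0 := ((t.mem_heart_iff _).1 X.property).1
      have hY : t.IsGE Y.obj 0 := ((t.mem_heart_iff _).1 Y.property).2
      exact t.zero_of_isLE_of_isGE f 0 (-n) (by lia) hX (t.isGE_shift Y.obj 0 n (-n))) f (admissibleMorphism_heart t f)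

end Heart

/-!
Let `t` be a t-structure on a full triangulated subcategory of `D⁺(A)`. If the graded pieces of
an object `K` of `D⁺F(A)` belong to the heart, then so do all the `Fil^i/Fil^j`, by extension
(`essImage_quot_obj`). For `i ≤ j ≤ k`, the distinguished triangle
`Fil^j/Fil^k ⟶ Fil^i/Fil^k ⟶ Fil^i/Fil^j` then consists of objects of the heart, so that its first
morphism is a monomorphism in the heart and its third object is the cokernel
(`mono_of_distTriang_heart`, `isColimit_of_distTriang_heart`). It follows that
`Fil^{-∞}/Fil^{+∞}`, with the subobjects `Fil^i/Fil^{+∞}`, is a filtered object of the heart, whose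
quotients are the `Fil^i/Fil^j`. This defines a functor `toFilteredObject`, compatible with the
functors `Fil^i/Fil^j`, and the point is to show that it is an equivalence.

This relies on filtered injective complexes, i.e. bounded below complexes whose filtration consists
of complexes of injective objects. The basic result `exists_hom_extension` constructs morphisms to
such a complex `I` by descending induction on the filtration. It has three consequences.
* Morphisms to `I` in `D⁺F(A)` are represented by morphisms of filtered complexes
  (`exists_Q_map_eq`).
* Any compatible family of morphisms in `D⁺(A)` between the steps of the filtrations of `K` and `I`
  lifts to a morphism of filtered complexes (`exists_hom_of_compatible`).
* Two morphisms `K ⟶ I` with the same effect on the steps of the filtrations in `D⁺(A)` are equal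
  in `D⁺F(A)`, as soon as there is no nonzero morphism `(Fil^{i+1} K)[1] ⟶ Fil^i I`
  (`Q_map_eq_of_Q_map_filMap_eq`).

When the graded pieces belong to the heart, the vanishing assumption in the last item holds by the
axioms of t-structures, so that `toFilteredObject` is fully faithful on morphisms to filtered
injective complexes. Finally, the steps of the filtration of any filtered object of the heart are
represented by a sequence of monomorphisms between bounded below complexes of injectives
(`exists_injective_sequence`), hence by a filtered injective complex (`exists_isInjective`). Its
graded pieces are cones of monomorphisms of the heart, and they belong to the heart
(`essImage_heart_of_mono`). This shows that `toFilteredObject` is essentially surjective. Applied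
to the filtered object attached to an object `K` of `D⁺F(A)`, the same construction shows that `K`
is isomorphic to a filtered injective complex (`exists_iso_ofComplex`).
-/

/-! ### Extension of morphisms to complexes of injectives -/

section FullSubcategory

open Pretriangulated

/-- A distinguished triangle whose objects and first two morphisms come from a full triangulated
subcategory is isomorphic to the image of a distinguished triangle of this subcategory. -/
lemma CategoryTheory.ObjectProperty.exists_distTriang_fullSubcategory {C : Type u} [Category.{v} C]
    [Preadditive C] [HasZeroObject C] [HasShift C ℤ] [∀ n : ℤ, (shiftFunctor C n).Additive]
    [Pretriangulated C] (P : ObjectProperty C) [P.IsTriangulated] {X Y Z : P.FullSubcategory}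
    (f : X ⟶ Y) (g : Y ⟶ Z) (δ : P.ι.obj Z ⟶ (P.ι.obj X)⟦(1 : ℤ)⟧)
    (h : Triangle.mk (P.ι.map f) (P.ι.map g) δ ∈ distTriang C) :
    ∃ δ' : Z ⟶ X⟦(1 : ℤ)⟧, Triangle.mk f g δ' ∈ distTriang P.FullSubcategory := by
  refine ⟨P.ι.preimage (δ ≫ (P.ι.commShiftIso (1 : ℤ)).inv.app X),
    isomorphic_distinguished _ h _
      (Triangle.isoMk _ _ (Iso.refl _) (Iso.refl _) (Iso.refl _) ?_ ?_ ?_)⟩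
  · exact (Category.comp_id _).trans (Category.id_comp _).symm
  · exact (Category.comp_id _).trans (Category.id_comp _).symm
  · change (P.ι.map (P.ι.preimage _) ≫ (P.ι.commShiftIso (1 : ℤ)).hom.app X) ≫
      (shiftFunctor C (1 : ℤ)).map (𝟙 (P.ι.obj X)) = 𝟙 _ ≫ δ
    rw [Functor.map_preimage, Functor.map_id, Category.assoc, Category.assoc,
      Iso.inv_hom_id_app_assoc, Category.id_comp]
    exact Category.comp_id _

end FullSubcategory

section DerivedCategoryPlus

open Pretriangulated

variable {A : Type u} [Category.{v} A] [Abelian A]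

instance : HasBinaryBiproducts (CochainComplex.Plus A) := .of_hasBinaryProducts

variable [HasDerivedCategory.{w} A]

instance : (DerivedCategory.Plus.Q (C := A)).Additive where
  map_add {_ _ f g} := DerivedCategory.Plus.ι.map_injective
    (DerivedCategory.Q.map_add (f := f.hom) (g := g.hom))

lemma exists_distTriang_of_shortExact (S : ShortComplex (CochainComplex.Plus A))
    (hS : (S.map (CochainComplex.Plus.ι A)).ShortExact) :
    ∃ (δ : DerivedCategory.Plus.Q.obj S.X₃ ⟶ (DerivedCategory.Plus.Q.obj S.X₁)⟦(1 : ℤ)⟧),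
      Triangle.mk (DerivedCategory.Plus.Q.map S.f) (DerivedCategory.Plus.Q.map S.g) δ ∈
        distTriang (DerivedCategory.Plus A) := by
  exact ObjectProperty.exists_distTriang_fullSubcategory _ _ _ _
    (DerivedCategory.triangleOfSES_distinguished hS)

/-- A morphism to a bounded below complex of injectives that is prescribed on a subcomplex and,
compatibly, in the derived category, extends to a morphism of complexes. -/
lemma exists_extension {P Z I : CochainComplex.Plus A} (j : P ⟶ Z) [Mono j]
    (hI : ∀ n, Injective (I.obj.X n)) (f : P ⟶ I)
    (φ : DerivedCategory.Plus.Q.obj Z ⟶ DerivedCategory.Plus.Q.obj I)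
    (h : DerivedCategory.Plus.Q.map j ≫ φ = DerivedCategory.Plus.Q.map f) :
    ∃ F : Z ⟶ I, j ≫ F = f ∧ DerivedCategory.Plus.Q.map F = φ := by
  -- by K-injectivity of `I`, `φ` comes from a morphism of complexes `f₀`
  obtain ⟨n, hn⟩ := I.property
  have : I.obj.IsKInjective := CochainComplex.isKInjective_of_injective _ n
  have hQ {X Y : CochainComplex.Plus A} (a b : X ⟶ Y) (H : Homotopy a.hom b.hom) :
      DerivedCategory.Plus.Q.map a = DerivedCategory.Plus.Q.map b :=
    DerivedCategory.Plus.ι.map_injective (DerivedCategory.Q_map_eq_of_homotopy _ H)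
  have hbij (X : CochainComplex.Plus A) := DerivedCategory.Plus.Qh_map_bijective_of_isKInjective
    ((HomotopyCategory.Plus.quotient A).obj X) ((HomotopyCategory.Plus.quotient A).obj I) this
  obtain ⟨f₀, rfl⟩ : ∃ f₀, DerivedCategory.Plus.Q.map f₀ = φ := by
    obtain ⟨g, hg⟩ := (hbij Z).surjective φ
    obtain ⟨f₀, rfl⟩ := (HomotopyCategory.Plus.quotient A).map_surjective g
    exact ⟨f₀, hg⟩
  have H : Homotopy f.hom (j ≫ f₀).hom := by
    rw [← Functor.map_comp] at h
    exact HomotopyCategory.homotopyOfEq _ _ ((HomotopyCategory.Plus.ι A).congr_map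
      ((hbij P).injective h.symm))
  -- the homotopy from `f` to `j ≫ f₀` extends along `j`, and `f₀` is modified
  -- by the null-homotopic morphism attached to this extension
  have (n : ℤ) : Mono (j.hom.f n) := inferInstance
  let s (m n : ℤ) : Z.obj.X m ⟶ I.obj.X n := Injective.factorThru (H.hom m n) (j.hom.f m)
  have hs (m n : ℤ) : j.hom.f m ≫ s m n = H.hom m n := Injective.comp_factorThru _ _
  let F : Z.obj ⟶ I.obj := f₀.hom + Homotopy.nullHomotopicMap' (fun m n _ => s m n)
  refine ⟨ObjectProperty.homMk F, ?_, hQ _ _ ?_⟩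
  · ext n
    have := H.comm n
    dsimp [F]
    rw [Homotopy.nullHomotopicMap'_f (k₂ := n - 1) (k₀ := n + 1) (by simp) (by simp)]
    rw [this, dNext_eq _ (show (ComplexShape.up ℤ).Rel n (n + 1) by simp),
      prevD_eq _ (show (ComplexShape.up ℤ).Rel (n - 1) n by simp)]
    simp only [Preadditive.comp_add, ← hs]
    simp [add_comm]
  · exact (Homotopy.add (Homotopy.refl _) (Homotopy.nullHomotopy' _)).trans
      (Homotopy.ofEq (add_zero _))

/-- The Mayer-Vietoris triangle of a pushout square along a monomorphism. -/
lemma exists_distTriang_of_isPushout {K₁ K₂ Z₁ P : CochainComplex.Plus A} {a : K₁ ⟶ K₂}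
    {j : K₁ ⟶ Z₁} {inl : K₂ ⟶ P} {inr : Z₁ ⟶ P} (sq : IsPushout a j inl inr) [Mono j] :
    ∃ (δ : DerivedCategory.Plus.Q.obj P ⟶ (DerivedCategory.Plus.Q.obj K₁)⟦(1 : ℤ)⟧),
      Triangle.mk (DerivedCategory.Plus.Q.map (biprod.lift a (-j)))
        (DerivedCategory.Plus.Q.map (biprod.desc inl inr)) δ ∈
        distTriang (DerivedCategory.Plus A) := by
  let F := CochainComplex.Plus.ι A
  let S : ShortComplex (CochainComplex.Plus A) :=
    ShortComplex.mk (biprod.lift a (-j)) (biprod.desc inl inr) (by simp [sq.w])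
  have : Mono S.f := by
    have : biprod.lift a (-j) ≫ (-biprod.snd) = j := by
      rw [Preadditive.comp_neg, biprod.lift_snd, neg_neg]
    exact mono_of_mono_fac this
  have : Epi S.g := by
    rw [Preadditive.epi_iff_cancel_zero]
    intro W x hx
    exact sq.hom_ext
      (by rw [comp_zero, ← biprod.inl_desc inl inr, Category.assoc]; exact hx ▸ comp_zero)
      (by rw [comp_zero, ← biprod.inr_desc inl inr, Category.assoc]; exact hx ▸ comp_zero)
  have hS : (S.map F).ShortExact :=
    { exact := ShortComplex.exact_of_g_is_cokernel _
        (CokernelCofork.mapIsColimit _ sq.isColimitCokernelCofork F)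
      mono_f := inferInstanceAs (Mono (F.map S.f))
      epi_g := inferInstanceAs (Epi (F.map S.g)) }
  exact exists_distTriang_of_shortExact _ hS

lemma Q_map_desc_comp_eq_zero {K₂ Z₁ P : CochainComplex.Plus A}
    {inl : K₂ ⟶ P} {inr : Z₁ ⟶ P} {Y : DerivedCategory.Plus A}
    (α : DerivedCategory.Plus.Q.obj P ⟶ Y)
    (h₁ : DerivedCategory.Plus.Q.map inl ≫ α = 0)
    (h₂ : DerivedCategory.Plus.Q.map inr ≫ α = 0) :
    DerivedCategory.Plus.Q.map (biprod.desc inl inr) ≫ α = 0 := by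
  have e : biprod.desc inl inr = biprod.fst ≫ inl + biprod.snd ≫ inr := by
    apply biprod.hom_ext' <;> simp
  rw [e, Functor.map_add, Preadditive.add_comp, Functor.map_comp, Functor.map_comp,
    Category.assoc, Category.assoc, h₁, h₂, comp_zero, comp_zero, add_zero]

/-- If `Hom(K₁[1], Y) = 0`, a morphism to `Y` from a pushout along a monomorphism is determined,
in the derived category, by its restrictions to the two summands. -/
lemma pushout_hom_ext_of_shift_zero {K₁ K₂ Z₁ P : CochainComplex.Plus A} {a : K₁ ⟶ K₂}
    {j : K₁ ⟶ Z₁} {inl : K₂ ⟶ P} {inr : Z₁ ⟶ P} (sq : IsPushout a j inl inr) [Mono j]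
    {Y : DerivedCategory.Plus A}
    (hY : ∀ β : (DerivedCategory.Plus.Q.obj K₁)⟦(1 : ℤ)⟧ ⟶ Y, β = 0)
    (α : DerivedCategory.Plus.Q.obj P ⟶ Y)
    (h₁ : DerivedCategory.Plus.Q.map inl ≫ α = 0)
    (h₂ : DerivedCategory.Plus.Q.map inr ≫ α = 0) : α = 0 := by
  obtain ⟨δ, hδ⟩ := exists_distTriang_of_isPushout sq
  obtain ⟨β, hβ⟩ := Triangle.yoneda_exact₃ _ hδ α (Q_map_desc_comp_eq_zero α h₁ h₂)
  rw [hβ, hY β]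
  exact comp_zero

/-- A morphism from a pushout along a monomorphism that is a quasi-isomorphism is determined,
in the derived category, by its restrictions to the two summands: the first morphism
of the Mayer-Vietoris triangle is a split monomorphism. -/
lemma pushout_hom_ext_of_isIso {K₁ K₂ Z₁ P : CochainComplex.Plus A} {a : K₁ ⟶ K₂}
    {j : K₁ ⟶ Z₁} {inl : K₂ ⟶ P} {inr : Z₁ ⟶ P} (sq : IsPushout a j inl inr) [Mono j]
    (hj : IsIso (DerivedCategory.Plus.Q.map j)) {Y : DerivedCategory.Plus A}
    (α : DerivedCategory.Plus.Q.obj P ⟶ Y)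
    (h₁ : DerivedCategory.Plus.Q.map inl ≫ α = 0)
    (h₂ : DerivedCategory.Plus.Q.map inr ≫ α = 0) : α = 0 := by
  obtain ⟨δ, hδ⟩ := exists_distTriang_of_isPushout sq
  have hm : Mono (DerivedCategory.Plus.Q.map (biprod.lift a (-j))) := by
    have : DerivedCategory.Plus.Q.map (biprod.lift a (-j)) ≫
        DerivedCategory.Plus.Q.map (-biprod.snd) = DerivedCategory.Plus.Q.map j := by
      rw [← Functor.map_comp, Preadditive.comp_neg, biprod.lift_snd, neg_neg]
    exact mono_of_mono_fac this
  have he : Epi (DerivedCategory.Plus.Q.map (biprod.desc inl inr)) :=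
    Triangle.epi₂ _ hδ (Triangle.mor₃_eq_zero_of_mono₁ _ hδ hm)
  rw [← cancel_epi (DerivedCategory.Plus.Q.map (biprod.desc inl inr)),
    Q_map_desc_comp_eq_zero α h₁ h₂, comp_zero]

end DerivedCategoryPlus

/-! ### Functorial cones -/

section Cone

variable {A : Type u} [Category.{v} A] [Abelian A]

namespace CochainComplex

/-- A contractible complex containing `K`, functorial in `K`: in degree `n` it is
`K^n ⊕ K^{n+1}`, and the differential is `(x, y) ↦ (y, 0)`. (It is isomorphic to the cone of
the identity of `K`, but its differential does not involve the differential of `K`.) -/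
noncomputable abbrev cone (K : CochainComplex A ℤ) : CochainComplex A ℤ where
  X n := K.X n ⊞ K.X (n + 1)
  d i j := if h : i + 1 = j then biprod.snd ≫ (K.XIsoOfEq h).hom ≫ biprod.inl else 0
  shape i j h := dif_neg h
  d_comp_d' i j k h h' := by
    obtain rfl : i + 1 = j := h
    obtain rfl : i + 1 + 1 = k := h'
    simp

/-- The morphism between cones induced by a morphism of complexes. -/
noncomputable abbrev coneMap {K L : CochainComplex A ℤ} (f : K ⟶ L) : K.cone ⟶ L.cone where
  f n := biprod.map (f.f n) (f.f (n + 1))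
  comm' i j h := by
    obtain rfl : i + 1 = j := h
    simp

/-- The embedding `x ↦ (x, dx)` of a complex into its cone. -/
noncomputable abbrev toCone (K : CochainComplex A ℤ) : K ⟶ K.cone where
  f n := biprod.lift (𝟙 _) (K.d n (n + 1))
  comm' i j h := by
    obtain rfl : i + 1 = j := h
    apply biprod.hom_ext <;> simp

lemma toCone_naturality {K L : CochainComplex A ℤ} (f : K ⟶ L) :
    f ≫ L.toCone = K.toCone ≫ coneMap f := by
  apply HomologicalComplex.hom_ext
  intro n
  change f.f n ≫ biprod.lift (𝟙 _) (L.d n (n + 1)) =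
    biprod.lift (𝟙 _) (K.d n (n + 1)) ≫ biprod.map (f.f n) (f.f (n + 1))
  apply biprod.hom_ext <;> simp

instance (K : CochainComplex A ℤ) : Mono K.toCone := by
  have (n : ℤ) : Mono (K.toCone.f n) :=
    mono_of_mono_fac (biprod.lift_fst (𝟙 (K.X n)) (K.d n (n + 1)))
  exact HomologicalComplex.mono_of_mono_f _ this

instance {K L : CochainComplex A ℤ} (f : K ⟶ L) [Mono f] : Mono (coneMap f) := by
  have (n : ℤ) : Mono ((coneMap f).f n) := inferInstanceAs (Mono (biprod.map _ _))
  exact HomologicalComplex.mono_of_mono_f _ this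

/-- The contracting homotopy `(x, y) ↦ (0, x)` of the cone. -/
noncomputable def coneHomotopy (K : CochainComplex A ℤ) : Homotopy (𝟙 K.cone) 0 where
  hom i j := if h : j + 1 = i then biprod.fst ≫ (K.XIsoOfEq h).inv ≫ biprod.inr else 0
  zero i j h := dif_neg h
  comm n := by
    rw [dNext_eq _ (show (ComplexShape.up ℤ).Rel n (n + 1) by simp),
      prevD_eq _ (show (ComplexShape.up ℤ).Rel (n - 1) n by simp)]
    simp only [HomologicalComplex.id_f, dif_pos, sub_add_cancel]
    apply biprod.hom_ext <;> apply biprod.hom_ext' <;> simp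

variable (A) in
/-- The cone functor on bounded below complexes. -/
noncomputable def Plus.coneFunctor : Plus A ⥤ Plus A where
  obj K := ⟨K.obj.cone, by
    obtain ⟨n, hn⟩ := K.property
    refine ⟨n - 1, (isStrictlyGE_iff _ _).2 fun i hi => ?_⟩
    rw [IsZero.iff_id_eq_zero]
    apply biprod.hom_ext
    · exact (K.obj.isZero_of_isStrictlyGE n i).eq_of_tgt _ _
    · exact (K.obj.isZero_of_isStrictlyGE n (i + 1)).eq_of_tgt _ _⟩
  map f := ObjectProperty.homMk (coneMap f.hom)
  map_id K := ObjectProperty.hom_ext _ (HomologicalComplex.hom_ext _ _ fun n => by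
    change biprod.map (𝟙 (K.obj.X n)) (𝟙 (K.obj.X (n + 1))) = 𝟙 _
    apply biprod.hom_ext <;> simp)
  map_comp f g := ObjectProperty.hom_ext _ (HomologicalComplex.hom_ext _ _ fun n => by
    change biprod.map (f.hom.f n ≫ g.hom.f n) (f.hom.f (n + 1) ≫ g.hom.f (n + 1)) =
      biprod.map (f.hom.f n) (f.hom.f (n + 1)) ≫ biprod.map (g.hom.f n) (g.hom.f (n + 1))
    apply biprod.hom_ext <;> simp)

variable (A) in
/-- The natural embedding of a bounded below complex into its cone. -/
noncomputable def Plus.toConeFunctor : 𝟭 (Plus A) ⟶ Plus.coneFunctor A where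
  app K := ObjectProperty.homMk K.obj.toCone
  naturality _ _ f := ObjectProperty.hom_ext _ (toCone_naturality f.hom)

instance (K : Plus A) : Mono ((Plus.toConeFunctor A).app K) :=
  (Plus.mono_iff _).2 (inferInstanceAs (Mono K.obj.toCone))

instance : (Plus.coneFunctor A).PreservesMonomorphisms where
  preserves {K L} f hf := (Plus.mono_iff _).2 (by
    have := (Plus.mono_iff f).1 hf
    exact inferInstanceAs (Mono (coneMap f.hom)))

instance : (Plus.coneFunctor A).PreservesZeroMorphisms where
  map_zero K L := ObjectProperty.hom_ext _ (HomologicalComplex.hom_ext _ _ fun n => by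
    change biprod.map (0 : K.obj.X n ⟶ L.obj.X n) (0 : K.obj.X (n + 1) ⟶ L.obj.X (n + 1)) = 0
    apply biprod.hom_ext <;> simp)

lemma Plus.isZero_Q_coneFunctor [HasDerivedCategory.{w} A] (K : Plus A) :
    IsZero (DerivedCategory.Plus.Q.obj ((Plus.coneFunctor A).obj K)) := by
  rw [IsZero.iff_id_eq_zero]
  apply DerivedCategory.Plus.ι.map_injective
  have := DerivedCategory.Q_map_eq_of_homotopy _ K.obj.coneHomotopy
  rw [CategoryTheory.Functor.map_id, Functor.map_zero] at this
  exact this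

end CochainComplex

end Cone

/-! ### Generalities on filtered objects -/

namespace FilteredObject

section

variable {C : Type u} [Category.{v} C]

lemma hom_ext {X Y : FilteredObject C} {f g : X ⟶ Y} (h : Hom.hom f = Hom.hom g) : f = g :=
  Hom.ext h

lemma filMap_eq {X Y : FilteredObject C} (f : X ⟶ Y) {i : EInt}
    {g : (X.fil i : C) ⟶ (Y.fil i : C)} (h : g ≫ (Y.fil i).arrow = (X.fil i).arrow ≫ Hom.hom f) :
    filMap f i = g := by
  rw [← cancel_mono (Y.fil i).arrow, filMap_arrow, h]

/-- A morphism of filtered objects, given by a morphism `f` between the underlying objects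
and compatible morphisms between the steps of the filtrations. -/
def homMk {X Y : FilteredObject C} (f : X.obj ⟶ Y.obj)
    (fi : ∀ i, (X.fil i : C) ⟶ (Y.fil i : C))
    (h : ∀ i, fi i ≫ (Y.fil i).arrow = (X.fil i).arrow ≫ f) : X ⟶ Y :=
  ⟨f, fun i => by rw [← h]; exact Subobject.factors_comp_arrow _⟩

@[simp]
lemma homMk_hom {X Y : FilteredObject C} (f : X.obj ⟶ Y.obj)
    (fi : ∀ i, (X.fil i : C) ⟶ (Y.fil i : C))
    (h : ∀ i, fi i ≫ (Y.fil i).arrow = (X.fil i).arrow ≫ f) : Hom.hom (homMk f fi h) = f := rfl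

lemma exists_le_isIso_arrow (X : FilteredObject C) :
    ∃ a : ℤ, ∀ i : EInt, i ≤ (a : EInt) → IsIso (X.fil i).arrow := by
  obtain ⟨a, ha⟩ := X.exists_fil_eq_bot
  refine ⟨a, fun i hi => (Subobject.isIso_arrow_iff_eq_top _).2 (top_le_iff.1 ?_)⟩
  rw [← X.fil_bot, ← ha]
  exact X.antitone_fil hi

lemma exists_ge_isZero [HasZeroMorphisms C] (X : FilteredObject C) :
    ∃ b : ℤ, ∀ i : EInt, (b : EInt) ≤ i → IsZero (X.fil i : C) := by
  obtain ⟨b, hb⟩ := X.exists_fil_eq_top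
  refine ⟨b, fun i hi => ?_⟩
  have h : X.fil i ≤ X.fil ⊤ := (X.antitone_fil hi).trans hb.le
  exact IsZero.of_mono (Subobject.ofLE _ _ h) X.isZero_fil_top

section OfMono

variable (X : C) (F : EInt → C) (m : ∀ i, F i ⟶ X) [∀ i, Mono (m i)]
  (hm : ∀ i j, i ≤ j → ∃ t : F j ⟶ F i, t ≫ m i = m j)
  (ha : ∃ a : ℤ, ∀ i : EInt, i ≤ (a : EInt) → IsIso (m i))
  (hb : ∃ b : ℤ, ∀ i : EInt, (b : EInt) ≤ i → IsZero (F i))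

/-- The filtered object given by a decreasing family of monomorphisms `F i ⟶ X`, which are
isomorphisms for `i` small and zero for `i` large. -/
noncomputable abbrev ofMono : FilteredObject C where
  obj := X
  fil i := Subobject.mk (m i)
  antitone_fil i j h := by
    obtain ⟨t, ht⟩ := hm i j h
    exact Subobject.mk_le_mk_of_comm t ht
  fil_bot := by
    obtain ⟨a, ha⟩ := ha
    have := ha ⊥ bot_le
    exact (Subobject.isIso_iff_mk_eq_top _).1 inferInstance
  isZero_fil_top := by
    obtain ⟨b, hb⟩ := hb
    exact (hb ⊤ le_top).of_iso (Subobject.underlyingIso _)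
  exists_fil_eq_bot := by
    obtain ⟨a, ha⟩ := ha
    have := ha ⊥ bot_le
    have := ha a le_rfl
    exact ⟨a, ((Subobject.isIso_iff_mk_eq_top _).1 inferInstance).trans
      ((Subobject.isIso_iff_mk_eq_top _).1 inferInstance).symm⟩
  exists_fil_eq_top := by
    obtain ⟨b, hb⟩ := hb
    exact ⟨b, le_antisymm
      (Subobject.mk_le_mk_of_comm ((hb b le_rfl).to_ _) ((hb b le_rfl).eq_of_src _ _))
      (Subobject.mk_le_mk_of_comm ((hb ⊤ le_top).to_ _) ((hb ⊤ le_top).eq_of_src _ _))⟩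

/-- The steps of the filtration of `FilteredObject.ofMono`. -/
noncomputable def ofMonoFilIso (i : EInt) : ((ofMono X F m hm ha hb).fil i : C) ≅ F i :=
  Subobject.underlyingIso (m i)

@[simp]
lemma ofMonoFilIso_hom_comp (i : EInt) :
    (ofMonoFilIso X F m hm ha hb i).hom ≫ m i = ((ofMono X F m hm ha hb).fil i).arrow :=
  Subobject.underlyingIso_hom_comp_eq_mk (m i)

@[simp]
lemma ofMonoFilIso_inv_arrow (i : EInt) :
    (ofMonoFilIso X F m hm ha hb i).inv ≫ ((ofMono X F m hm ha hb).fil i).arrow = m i :=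
  Subobject.underlyingIso_arrow (m i)

end OfMono

lemma nonempty_quot_iso_of_eq [HasZeroMorphisms C] [HasCokernels C] (X : FilteredObject C)
    {i j i' j' : EInt} (h : i ≤ j) (h' : i' ≤ j') (hi : X.fil i = X.fil i')
    (hj : X.fil j = X.fil j') : Nonempty ((quot i j h).obj X ≅ (quot i' j' h').obj X) :=
  ⟨cokernel.mapIso _ _ (Subobject.isoOfEq _ _ hj) (Subobject.isoOfEq _ _ hi)
    ((Subobject.ofLE_comp_ofLE _ _ _ _ _).trans (Subobject.ofLE_comp_ofLE _ _ _ _ _).symm)⟩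

/-- A morphism of filtered objects is determined by its effect on `Fil^{-∞}`. -/
lemma hom_ext_filMap {X Y : FilteredObject C} {f g : X ⟶ Y} (h : filMap f ⊥ = filMap g ⊥) :
    f = g := by
  have := X.isIso_fil_bot_arrow
  apply hom_ext
  rw [← cancel_epi (X.fil ⊥).arrow, ← filMap_arrow, h, filMap_arrow]

/-- Compatible morphisms between the steps of the filtrations define a morphism of
filtered objects. -/
lemma exists_filMap_eq {X Y : FilteredObject C} (κ : ∀ i, (X.fil i : C) ⟶ (Y.fil i : C))
    (hκ : ∀ i j (h : i ≤ j), X.incl h ≫ κ i = κ j ≫ Y.incl h) :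
    ∃ f : X ⟶ Y, ∀ i, filMap f i = κ i := by
  have hf (i : EInt) : κ i ≫ (Y.fil i).arrow =
      (X.fil i).arrow ≫ X.filBotIso.inv ≫ κ ⊥ ≫ (Y.fil ⊥).arrow := by
    have h₁ : (X.fil i).arrow ≫ X.filBotIso.inv = X.incl bot_le := by
      rw [Iso.comp_inv_eq, filBotIso_hom, incl_arrow]
    rw [← Category.assoc, h₁, ← Category.assoc, hκ, Category.assoc, incl_arrow]
  exact ⟨homMk _ κ hf, fun i => filMap_eq _ (hf i)⟩

lemma isIso_of_isIso_filMap {X Y : FilteredObject C} (f : X ⟶ Y)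
    (hf : ∀ i, IsIso (filMap f i)) : IsIso f := by
  obtain ⟨g, hg⟩ := exists_filMap_eq (X := Y) (Y := X) (fun i => inv (filMap f i))
    (fun i j h => by
      rw [← cancel_epi (filMap f j), IsIso.hom_inv_id_assoc, ← Category.assoc, ← incl_filMap,
        Category.assoc, IsIso.hom_inv_id, Category.comp_id])
  exact ⟨g, hom_ext_filMap (by rw [filMap_comp, hg, filMap_id, IsIso.hom_inv_id]),
    hom_ext_filMap (by rw [filMap_comp, hg, filMap_id, IsIso.inv_hom_id])⟩

end

end FilteredObject

/-! ### Strict monomorphisms, direct sums and cones of filtered objects -/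

namespace FilteredObject

section

variable {C : Type u} [Category.{v} C]

/-- Strictness of a morphism of filtered objects that is a monomorphism: the filtration of the
source is induced by the filtration of the target. -/
structure IsStrictMono {X Y : FilteredObject C} (f : X ⟶ Y) : Prop where
  mono : Mono (Hom.hom f)
  factors (i : EInt) ⦃T : C⦄ (x : T ⟶ X.obj) :
    (Y.fil i).Factors (x ≫ Hom.hom f) → (X.fil i).Factors x

lemma IsStrictMono.mono_filMap {X Y : FilteredObject C} {f : X ⟶ Y} (hf : IsStrictMono f)
    (i : EInt) : Mono (filMap f i) := by
  have := hf.mono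
  have : Mono (filMap f i ≫ (Y.fil i).arrow) := by
    rw [filMap_arrow]
    infer_instance
  exact mono_of_mono (filMap f i) (Y.fil i).arrow

lemma IsStrictMono.isPullback {X Y : FilteredObject C} {f : X ⟶ Y} (hf : IsStrictMono f)
    {i j : EInt} (h : i ≤ j) :
    IsPullback (X.incl h) (filMap f j) (filMap f i) (Y.incl h) := by
  have key (s : PullbackCone (filMap f i) (Y.incl h)) :
      ∃ l : s.pt ⟶ (X.fil j : C), l ≫ X.incl h = s.fst := by
    have : (s.fst ≫ (X.fil i).arrow) ≫ Hom.hom f = s.snd ≫ (Y.fil j).arrow := by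
      rw [Category.assoc, ← filMap_arrow, ← Category.assoc, s.condition, Category.assoc, incl_arrow]
    have hl : (X.fil j).Factors (s.fst ≫ (X.fil i).arrow) :=
      hf.factors _ _ (by rw [this]; exact Subobject.factors_comp_arrow _)
    exact ⟨(X.fil j).factorThru _ hl, by
      rw [← cancel_mono (X.fil i).arrow, Category.assoc, incl_arrow, Subobject.factorThru_arrow]⟩
  choose l hl using key
  refine ⟨⟨incl_filMap f h⟩, ⟨PullbackCone.IsLimit.mk _ l hl (fun s => ?_) (fun s m h₁ _ => ?_)⟩⟩
  · rw [← cancel_mono (Y.incl h), Category.assoc, ← incl_filMap, ← Category.assoc, hl, s.condition]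
  · rw [← cancel_mono (X.incl h), h₁, hl]

section Biprod

variable [Preadditive C] [HasBinaryBiproducts C] (X Y : FilteredObject C)

instance mono_biprod_map {X₁ X₂ Y₁ Y₂ : C} (f : X₁ ⟶ Y₁) (g : X₂ ⟶ Y₂) [Mono f] [Mono g] :
    Mono (biprod.map f g) := by
  refine Preadditive.mono_of_cancel_zero _ fun x hx => biprod.hom_ext _ _ ?_ ?_
  · rw [zero_comp, ← cancel_mono f, zero_comp, Category.assoc, ← biprod.map_fst f g,
      ← Category.assoc, hx, zero_comp]
  · rw [zero_comp, ← cancel_mono g, zero_comp, Category.assoc, ← biprod.map_snd f g,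
      ← Category.assoc, hx, zero_comp]

/-- The direct sum of two filtered objects. -/
noncomputable abbrev biprod : FilteredObject C :=
  ofMono (X.obj ⊞ Y.obj) (fun i => (X.fil i : C) ⊞ (Y.fil i : C))
    (fun i => biprod.map (X.fil i).arrow (Y.fil i).arrow)
    (fun i j h => ⟨biprod.map (X.incl h) (Y.incl h), by
      apply biprod.hom_ext <;> simp⟩)
    (by
      obtain ⟨a, ha⟩ := X.exists_le_isIso_arrow
      obtain ⟨b, hb⟩ := Y.exists_le_isIso_arrow
      refine ⟨min a b, fun i hi => ?_⟩
      have := ha i (hi.trans (WithBotTop.coe_le_coe.2 (min_le_left a b)))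
      have := hb i (hi.trans (WithBotTop.coe_le_coe.2 (min_le_right a b)))
      exact (biprod.mapIso (asIso (X.fil i).arrow) (asIso (Y.fil i).arrow)).isIso_hom)
    (by
      obtain ⟨a, ha⟩ := X.exists_ge_isZero
      obtain ⟨b, hb⟩ := Y.exists_ge_isZero
      refine ⟨max a b, fun i hi => ?_⟩
      have h₁ := ha i (le_trans (WithBotTop.coe_le_coe.2 (le_max_left a b)) hi)
      have h₂ := hb i (le_trans (WithBotTop.coe_le_coe.2 (le_max_right a b)) hi)
      rw [IsZero.iff_id_eq_zero]
      exact biprod.hom_ext _ _ (h₁.eq_of_tgt _ _) (h₂.eq_of_tgt _ _))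

/-- The steps of the filtration of a direct sum. -/
noncomputable def biprodFilIso (i : EInt) :
    ((biprod X Y).fil i : C) ≅ (X.fil i : C) ⊞ (Y.fil i : C) :=
  ofMonoFilIso _ _ _ _ _ _ i

lemma biprodFilIso_inv_arrow (i : EInt) : (biprodFilIso X Y i).inv ≫ ((biprod X Y).fil i).arrow =
    biprod.map (X.fil i).arrow (Y.fil i).arrow :=
  ofMonoFilIso_inv_arrow ..

lemma biprodFilIso_hom_map (i : EInt) : (biprodFilIso X Y i).hom ≫
    biprod.map (X.fil i).arrow (Y.fil i).arrow = ((biprod X Y).fil i).arrow :=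
  ofMonoFilIso_hom_comp ..

/-- The first projection. -/
noncomputable def fst : biprod X Y ⟶ X :=
  homMk biprod.fst (fun i => (biprodFilIso X Y i).hom ≫ biprod.fst) (fun i => by
    rw [← biprodFilIso_hom_map, Category.assoc, Category.assoc, biprod.map_fst])

variable {X Y} in
/-- The morphism to a direct sum given by its two components. -/
noncomputable def lift {T : FilteredObject C} (f : T ⟶ X) (g : T ⟶ Y) : T ⟶ biprod X Y :=
  homMk (biprod.lift (Hom.hom f) (Hom.hom g))
    (fun i => biprod.lift (filMap f i) (filMap g i) ≫ (biprodFilIso X Y i).inv) (fun i => by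
      rw [Category.assoc, biprodFilIso_inv_arrow]
      apply biprod.hom_ext <;> simp)

variable {X Y} in
/-- The morphism from a direct sum given by its two components. -/
noncomputable def desc {T : FilteredObject C} (f : X ⟶ T) (g : Y ⟶ T) : biprod X Y ⟶ T :=
  homMk (biprod.desc (Hom.hom f) (Hom.hom g))
    (fun i => (biprodFilIso X Y i).hom ≫ biprod.desc (filMap f i) (filMap g i)) (fun i => by
      rw [← biprodFilIso_hom_map, Category.assoc, Category.assoc]
      congr 1
      apply biprod.hom_ext' <;> simp)

variable {X Y} in
lemma lift_fst {T : FilteredObject C} (f : T ⟶ X) (g : T ⟶ Y) : lift f g ≫ fst X Y = f :=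
  hom_ext (biprod.lift_fst _ _)

lemma filMap_fst (i : EInt) : filMap (fst X Y) i = (biprodFilIso X Y i).hom ≫ biprod.fst := by
  apply filMap_eq
  dsimp [fst]
  rw [← biprodFilIso_hom_map, Category.assoc, Category.assoc, biprod.map_fst]

variable {X Y} in
lemma isStrictMono_lift {T : FilteredObject C} (f : T ⟶ X) {g : T ⟶ Y} (hg : IsStrictMono g) :
    IsStrictMono (lift f g) := by
  refine ⟨?_, fun i Z x hx => hg.factors _ _ ?_⟩
  · have := hg.mono
    exact mono_of_mono_fac (biprod.lift_snd (Hom.hom f) (Hom.hom g))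
  · have : x ≫ Hom.hom g = ((biprod X Y).fil i).factorThru _ hx ≫ (biprodFilIso X Y i).hom ≫
        biprod.snd ≫ (Y.fil i).arrow := by
      rw [← biprod.map_snd (X.fil i).arrow (Y.fil i).arrow, reassoc_of% biprodFilIso_hom_map,
        Subobject.factorThru_arrow_assoc]
      dsimp [lift]
      rw [Category.assoc]
      congr 1
      exact (biprod.lift_snd _ _).symm
    rw [this, ← Category.assoc, ← Category.assoc]
    exact Subobject.factors_comp_arrow _

end Biprod

variable (C) in
/-- The zero filtered object. -/
noncomputable abbrev zero [HasZeroObject C] : FilteredObject C :=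
  open ZeroObject in
  ofMono (0 : C) (fun _ => (0 : C)) (fun _ => 𝟙 _) (fun _ _ _ => ⟨𝟙 _, by simp⟩)
    ⟨0, fun _ _ => inferInstance⟩ ⟨0, fun _ _ => isZero_zero C⟩

end

section Cone

variable {A : Type u} [Category.{v} A] [Abelian A]

open CochainComplex.Plus

/-- The cone of a filtered complex, with the filtration given by the cones of the steps. -/
noncomputable abbrev cone (K : FilteredObject (CochainComplex.Plus A)) :
    FilteredObject (CochainComplex.Plus A) :=
  ofMono ((coneFunctor A).obj K.obj) (fun i => (coneFunctor A).obj (K.fil i : _))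
    (fun i => (coneFunctor A).map (K.fil i).arrow)
    (fun _ _ h => ⟨(coneFunctor A).map (K.incl h), by rw [← Functor.map_comp, incl_arrow]⟩)
    (by
      obtain ⟨a, ha⟩ := K.exists_le_isIso_arrow
      refine ⟨a, fun i hi => ?_⟩
      have := ha i hi
      infer_instance)
    (by
      obtain ⟨b, hb⟩ := K.exists_ge_isZero
      exact ⟨b, fun i hi => Functor.map_isZero _ (hb i hi)⟩)

/-- The steps of the filtration of the cone. -/
noncomputable def coneFilIso (K : FilteredObject (CochainComplex.Plus A)) (i : EInt) :
    (K.cone.fil i : CochainComplex.Plus A) ≅ (coneFunctor A).obj (K.fil i : _) :=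
  ofMonoFilIso _ _ _ _ _ _ i

lemma coneFilIso_inv_arrow (K : FilteredObject (CochainComplex.Plus A)) (i : EInt) :
    (K.coneFilIso i).inv ≫ (K.cone.fil i).arrow = (coneFunctor A).map (K.fil i).arrow :=
  ofMonoFilIso_inv_arrow ..

lemma coneFilIso_hom_map (K : FilteredObject (CochainComplex.Plus A)) (i : EInt) :
    (K.coneFilIso i).hom ≫ (coneFunctor A).map (K.fil i).arrow = (K.cone.fil i).arrow :=
  ofMonoFilIso_hom_comp ..

/-- The embedding of a filtered complex into its cone. -/
noncomputable def toCone (K : FilteredObject (CochainComplex.Plus A)) : K ⟶ K.cone :=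
  homMk ((toConeFunctor A).app K.obj)
    (fun i => (toConeFunctor A).app (K.fil i : _) ≫ (K.coneFilIso i).inv) (fun i => by
      rw [Category.assoc, coneFilIso_inv_arrow]
      exact ((toConeFunctor A).naturality _).symm)

/-- In the category of bounded below complexes, a monomorphism is a kernel of its cokernel. -/
lemma exists_lift_of_comp_cokernel_π {K L T : CochainComplex.Plus A} (m : K ⟶ L) [Mono m]
    (x : T ⟶ L) (hx : x ≫ cokernel.π m = 0) : ∃ y : T ⟶ K, y ≫ m = x := by
  let F := CochainComplex.Plus.ι A
  have hc : IsColimit (CokernelCofork.ofπ (F.map (cokernel.π m))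
      (by rw [← F.map_comp, cokernel.condition, F.map_zero])) :=
    isColimitOfHasCokernelOfPreservesColimit F m
  have hex : (ShortComplex.mk (F.map m) (F.map (cokernel.π m))
    (by rw [← F.map_comp, cokernel.condition, F.map_zero])).Exact :=
    ShortComplex.exact_of_g_is_cokernel _ hc
  have : Mono (F.map m) := inferInstance
  obtain ⟨y, hy⟩ := KernelFork.IsLimit.lift' hex.fIsKernel (F.map x)
    (by dsimp; rw [← F.map_comp, hx, F.map_zero])
  exact ⟨F.preimage y, F.map_injective (by rw [F.map_comp, F.map_preimage]; exact hy)⟩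

lemma isStrictMono_toCone (K : FilteredObject (CochainComplex.Plus A)) :
    IsStrictMono K.toCone := by
  refine ⟨inferInstanceAs (Mono ((toConeFunctor A).app K.obj)), fun i T x hx => ?_⟩
  have hx' : x ≫ (toConeFunctor A).app K.obj =
      ((K.cone.fil i).factorThru _ hx ≫ (K.coneFilIso i).hom) ≫
        (coneFunctor A).map (K.fil i).arrow := by
    rw [Category.assoc, coneFilIso_hom_map, Subobject.factorThru_arrow]
    rfl
  obtain ⟨y, hy⟩ := exists_lift_of_comp_cokernel_π (K.fil i).arrow x (by
    rw [← cancel_mono ((toConeFunctor A).app (cokernel (K.fil i).arrow)), zero_comp]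
    have := (toConeFunctor A).naturality (cokernel.π (K.fil i).arrow)
    dsimp only [Functor.id_map, Functor.id_obj] at this
    rw [Category.assoc, this, ← Category.assoc, hx', Category.assoc, ← Functor.map_comp,
      cokernel.condition, Functor.map_zero, comp_zero])
  rw [← hy]
  exact Subobject.factors_comp_arrow _

end Cone

end FilteredObject

/-! ### Extension of morphisms to filtered injective complexes -/

namespace FilteredObject

section

variable {A : Type u} [Category.{v} A] [Abelian A] [HasDerivedCategory.{w} A]

open DerivedCategory.Plus

lemma isIso_Q_map_iff {K L : CochainComplex.Plus A} (f : K ⟶ L) :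
    IsIso (Q.map f) ↔ CochainComplex.Plus.quasiIso A f := by
  refine ⟨fun h => ?_, FilteredDerivedCategory.isIso_Q_map f⟩
  have : IsIso (DerivedCategory.Q.map f.hom) :=
    inferInstanceAs (IsIso (DerivedCategory.Plus.ι.map (Q.map f)))
  exact (DerivedCategory.isIso_Q_map_iff_quasiIso _ _).1 this

lemma isIso_proj_top {C : Type*} [Category* C] [HasZeroMorphisms C] [HasCokernels C]
    (K : FilteredObject C) (i : EInt) : IsIso (K.proj (le_top : i ≤ ⊤)) :=
  cokernel.π_of_zero (K.isZero_fil_top.eq_of_src _ _)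

lemma incl_refl {C : Type*} [Category* C] (X : FilteredObject C) (i : EInt) :
    X.incl (le_refl i) = 𝟙 _ := by
  simp [incl]

open HomologicalComplex.HomologySequence in
/-- A morphism of filtered complexes is a filtered quasi-isomorphism if and only if it induces
quasi-isomorphisms on all the steps of the filtrations. -/
lemma quasiIso_iff_isIso_Q_map_filMap {K L : FilteredObject (CochainComplex.Plus A)} (f : K ⟶ L) :
    FilteredDerivedCategory.quasiIso A f ↔ ∀ i, IsIso (Q.map (filMap f i)) := by
  have hproj (i : EInt) : CochainComplex.Plus.quasiIso A ((quot i ⊤ le_top).map f) ↔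
      IsIso (Q.map (filMap f i)) := by
    rw [isIso_Q_map_iff]
    exact ((CochainComplex.Plus.quasiIso A).arrow_mk_iso_iff (Arrow.isoMk
      (@asIso _ _ _ _ (K.proj le_top) (K.isIso_proj_top i))
      (@asIso _ _ _ _ (L.proj le_top) (L.isIso_proj_top i)) (proj_quot_map f le_top))).symm
  refine ⟨fun hf i => (hproj i).1 (FilteredDerivedCategory.quasiIso_quot_map f hf i ⊤ le_top),
    fun hf i => ?_⟩
  have h₁ : (i : EInt) ≤ ((i + 1 : ℤ) : EInt) := WithBotTop.coe_le_coe.2 (by lia)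
  exact quasiIso_τ₃ ((CochainComplex.Plus.ι A).mapShortComplex.map
    (quotSequenceMap h₁ le_top f)) (quotSequence_shortExact h₁ le_top K)
    (quotSequence_shortExact h₁ le_top L) ((hproj _).2 (hf _)) ((hproj _).2 (hf _))

/-- A filtered complex is filtered injective if all the steps of the filtration consist of
injective objects. (The filtration then splits in each degree.) -/
def IsInjective (I : FilteredObject (CochainComplex.Plus A)) : Prop :=
  ∀ (i : EInt) (n : ℤ), Injective ((I.fil i : CochainComplex.Plus A).obj.X n)

/-- Let `j : K ⟶ Z` be a strict monomorphism of filtered complexes and `I` a filtered injective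
complex. A morphism `g : K ⟶ I` extends to a morphism `Z ⟶ I` inducing prescribed compatible
morphisms `φ i` in the derived category on the steps of the filtrations, provided that, for all
`i ∈ ℤ`, a morphism to `Fil^i I` in the derived category from the pushout of `Fil^i K` and
`Fil^{i+1} Z` over `Fil^{i+1} K` (which is the subcomplex `Fil^i K + Fil^{i+1} Z` of `Fil^i Z`)
vanishes as soon as its restrictions to `Fil^i K` and `Fil^{i+1} Z` do. The extension is
constructed by descending induction on the index of the filtration, using `exists_extension` for
this subcomplex. -/
lemma exists_hom_extension {K Z I : FilteredObject (CochainComplex.Plus A)} {j : K ⟶ Z}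
    (hj : IsStrictMono j) (hI : I.IsInjective) (g : K ⟶ I)
    (φ : ∀ i, Q.obj (Z.fil i : CochainComplex.Plus A) ⟶ Q.obj (I.fil i : CochainComplex.Plus A))
    (hφ : ∀ i i' (h : i ≤ i'), φ i' ≫ Q.map (I.incl h) = Q.map (Z.incl h) ≫ φ i)
    (hφg : ∀ i, Q.map (filMap j i) ≫ φ i = Q.map (filMap g i))
    (H : ∀ (i : ℤ) (α : Q.obj (pushout (K.incl (WithBotTop.coe_le_coe.2 (by lia) :
        (i : EInt) ≤ ((i + 1 : ℤ) : EInt))) (filMap j ((i + 1 : ℤ) : EInt))) ⟶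
        Q.obj (I.fil (i : EInt) : CochainComplex.Plus A)),
      Q.map (pushout.inl _ _) ≫ α = 0 → Q.map (pushout.inr _ _) ≫ α = 0 → α = 0) :
    ∃ h : Z ⟶ I, j ≫ h = g ∧ ∀ i, Q.map (filMap h i) = φ i := by
  obtain ⟨b₁, hb₁⟩ := Z.exists_ge_isZero
  obtain ⟨b₂, hb₂⟩ := K.exists_ge_isZero
  let b := max b₁ b₂
  have hbZ (i : EInt) (hi : (b : EInt) ≤ i) : IsZero (Z.fil i : CochainComplex.Plus A) :=
    hb₁ i (le_trans (WithBotTop.coe_le_coe.2 (le_max_left _ _)) hi)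
  have hbK (i : EInt) (hi : (b : EInt) ≤ i) : IsZero (K.fil i : CochainComplex.Plus A) :=
    hb₂ i (le_trans (WithBotTop.coe_le_coe.2 (le_max_right _ _)) hi)
  -- descending induction, starting from an index `b` above which the filtrations vanish;
  -- on the steps inside `Fil^{b-n} Z`, the extension is obtained by restriction
  have key (n : ℕ) : ∃ h : (Z.fil ((b - n : ℤ) : EInt) : CochainComplex.Plus A) ⟶
      (I.fil ((b - n : ℤ) : EInt) : CochainComplex.Plus A),
      ∀ (k : EInt) (hk : ((b - n : ℤ) : EInt) ≤ k),
        ∃ hk' : (Z.fil k : CochainComplex.Plus A) ⟶ (I.fil k : CochainComplex.Plus A),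
          hk' ≫ I.incl hk = Z.incl hk ≫ h ∧ filMap j k ≫ hk' = filMap g k ∧ Q.map hk' = φ k := by
    induction n with
    | zero =>
      refine ⟨0, fun k hk => ⟨0, ?_, ?_, ?_⟩⟩
      · rw [zero_comp, comp_zero]
      · exact (hbK k (by simpa using hk)).eq_of_src _ _
      · exact (Functor.map_isZero Q (hbZ k (by simpa using hk))).eq_of_src _ _
    | succ n hn =>
      obtain ⟨h, hh⟩ := hn
      generalize hi : (b - n : ℤ) = i' at h hh
      generalize hi' : (b - (n + 1 : ℕ) : ℤ) = i
      obtain rfl : i' = i + 1 := by lia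
      have hle : (i : EInt) ≤ ((i + 1 : ℤ) : EInt) := WithBotTop.coe_le_coe.2 (by lia)
      obtain ⟨h', hh₁, hh₂, hh₃⟩ := hh _ le_rfl
      let P := pushout (K.incl hle) (filMap j ((i + 1 : ℤ) : EInt))
      let f : P ⟶ (I.fil (i : EInt) : CochainComplex.Plus A) :=
        pushout.desc (filMap g i) (h' ≫ I.incl hle) (by
          rw [incl_filMap, ← Category.assoc, hh₂])
      let m : P ⟶ (Z.fil (i : EInt) : CochainComplex.Plus A) :=
        pushout.desc (filMap j i) (Z.incl hle) (incl_filMap _ _)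
      have : Mono m := by
        have := hj.mono_filMap i
        -- by strictness, `Fil^{i+1} K` is the intersection of `Fil^i K` and `Fil^{i+1} Z`
        have sq₁ := (IsPushout.of_hasPushout (K.incl hle)
          (filMap j ((i + 1 : ℤ) : EInt))).map (CochainComplex.Plus.ι A)
        have sq₂ := (hj.isPullback hle).map (CochainComplex.Plus.ι A)
        have : Mono ((CochainComplex.Plus.ι A).map m) :=
          sq₁.mono_of_isPullback_of_mono sq₂ _
            (by rw [← Functor.map_comp, pushout.inl_desc])
            (by rw [← Functor.map_comp, pushout.inr_desc])
        exact (CochainComplex.Plus.ι A).mono_of_mono_map this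
      obtain ⟨F, hF₁, hF₂⟩ := exists_extension m (hI i) f (φ i) (by
        rw [← sub_eq_zero]
        apply H
        · rw [Preadditive.comp_sub, ← Category.assoc, ← Functor.map_comp, ← Functor.map_comp,
            pushout.inl_desc, pushout.inl_desc, hφg, sub_self]
        · rw [Preadditive.comp_sub, ← Category.assoc, ← Functor.map_comp, ← Functor.map_comp,
            pushout.inr_desc, pushout.inr_desc, ← hφ, Functor.map_comp, hh₃, sub_self])
      refine ⟨F, fun k hk => ?_⟩
      by_cases hk' : ((i + 1 : ℤ) : EInt) ≤ k
      · obtain ⟨a, ha₁, ha₂, ha₃⟩ := hh k hk'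
        refine ⟨a, ?_, ha₂, ha₃⟩
        have e₁ : Z.incl hle ≫ F = h' ≫ I.incl hle := by
          rw [← pushout.inr_desc (filMap j i) (Z.incl hle) (incl_filMap _ _), Category.assoc]
          change _ ≫ m ≫ F = _
          rw [hF₁, pushout.inr_desc]
        have e₂ : h' = h := by
          rw [incl_refl, incl_refl, Category.comp_id, Category.id_comp] at hh₁
          exact hh₁
        rw [← I.incl_comp_incl hle hk', ← Category.assoc, ha₁, Category.assoc, ← e₂, ← e₁,
          ← Category.assoc, incl_comp_incl]
      · have hki : k = (i : EInt) := by
          induction k using WithBotTop.rec with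
          | bot => exact absurd (le_bot_iff.1 hk) (WithBotTop.coe_ne_bot i)
          | coe k =>
            have h₁ := WithBotTop.coe_le_coe.1 hk
            have h₂ : ¬ (i + 1 ≤ k) := fun h => hk' (WithBotTop.coe_le_coe.2 h)
            obtain rfl : k = i := by lia
            rfl
          | top => exact absurd le_top hk'
        subst hki
        refine ⟨F, ?_, ?_, hF₂⟩
        · rw [incl_refl, incl_refl, Category.comp_id, Category.id_comp]
        · rw [← pushout.inl_desc (filMap j i) (Z.incl hle) (incl_filMap _ _), Category.assoc]
          change _ ≫ m ≫ F = _
          rw [hF₁, pushout.inl_desc]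
  -- `Fil^i` is the whole complex for `i` small, so that the induction reaches `Z` itself
  obtain ⟨a₁, ha₁⟩ := Z.exists_le_isIso_arrow
  obtain ⟨a₂, ha₂⟩ := K.exists_le_isIso_arrow
  obtain ⟨n, hn⟩ : ∃ n : ℕ, b - n ≤ min a₁ a₂ := ⟨(b - min a₁ a₂).toNat, by lia⟩
  obtain ⟨h, hh⟩ := key n
  generalize (b - n : ℤ) = c at h hh hn
  have hZ : IsIso (Z.fil (c : EInt)).arrow :=
    ha₁ _ (WithBotTop.coe_le_coe.2 (hn.trans (min_le_left _ _)))
  have hK : IsIso (K.fil (c : EInt)).arrow :=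
    ha₂ _ (WithBotTop.coe_le_coe.2 (hn.trans (min_le_right _ _)))
  obtain ⟨h', hh₁, hh₂, hh₃⟩ := hh _ le_rfl
  obtain rfl : h' = h := by
    rw [incl_refl, incl_refl, Category.comp_id, Category.id_comp] at hh₁
    exact hh₁
  obtain ⟨F, hF₀⟩ : ∃ F : Z.obj ⟶ I.obj,
      (Z.fil (c : EInt)).arrow ≫ F = h' ≫ (I.fil (c : EInt)).arrow :=
    ⟨inv (Z.fil (c : EInt)).arrow ≫ h' ≫ (I.fil (c : EInt)).arrow, by simp⟩
  have hF (k : EInt) : ∃ f : (Z.fil k : CochainComplex.Plus A) ⟶ (I.fil k : CochainComplex.Plus A),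
      f ≫ (I.fil k).arrow = (Z.fil k).arrow ≫ F ∧ Q.map f = φ k := by
    obtain hk | hk := le_total (c : EInt) k
    · obtain ⟨f, hf₁, -, hf₃⟩ := hh k hk
      refine ⟨f, ?_, hf₃⟩
      rw [← I.incl_arrow hk, ← Category.assoc, hf₁, Category.assoc, ← hF₀, ← Category.assoc,
        Z.incl_arrow hk]
    · have : IsIso (Z.fil k).arrow := ha₁ _ (hk.trans
        (WithBotTop.coe_le_coe.2 (hn.trans (min_le_left _ _))))
      have : IsIso (Z.incl hk) := by
        have : IsIso (Z.incl hk ≫ (Z.fil k).arrow) := by rwa [incl_arrow]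
        exact IsIso.of_isIso_comp_right _ (Z.fil k).arrow
      refine ⟨inv (Z.incl hk) ≫ h' ≫ I.incl hk, ?_, ?_⟩
      · rw [← cancel_epi (Z.incl hk), ← Category.assoc (Z.incl hk) _ F, Z.incl_arrow hk]
        rw [hF₀]
        simp
      · rw [← cancel_epi (Q.map (Z.incl hk)), ← hφ, ← Functor.map_comp, IsIso.hom_inv_id_assoc,
          Functor.map_comp, hh₃]
  choose f hf₁ hf₂ using hF
  refine ⟨homMk F f hf₁, hom_ext ?_, fun k => ?_⟩
  · rw [← cancel_epi (K.fil (c : EInt)).arrow]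
    change _ ≫ Hom.hom j ≫ F = _
    rw [← filMap_arrow, ← hh₂, Category.assoc, ← hF₀, ← Category.assoc, ← Category.assoc,
      filMap_arrow]
  · rw [filMap_eq (homMk F f hf₁) (hf₁ k), hf₂]

end

end FilteredObject

/-! ### Morphisms to filtered injective complexes in the filtered derived category -/

namespace FilteredObject

section

variable {C : Type u} [Category.{v} C] [Preadditive C]

/-- The difference of two morphisms of filtered objects. -/
noncomputable def sub {X Y : FilteredObject C} (f g : X ⟶ Y) : X ⟶ Y :=
  homMk (Hom.hom f - Hom.hom g) (fun i => filMap f i - filMap g i) (fun i => by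
    rw [Preadditive.sub_comp, filMap_arrow, filMap_arrow, Preadditive.comp_sub])

lemma filMap_sub {X Y : FilteredObject C} (f g : X ⟶ Y) (i : EInt) :
    filMap (sub f g) i = filMap f i - filMap g i := by
  apply filMap_eq
  rw [Preadditive.sub_comp, filMap_arrow, filMap_arrow, ← Preadditive.comp_sub]
  rfl

/-- The zero morphism between filtered objects. -/
noncomputable def zeroHom (X Y : FilteredObject C) : X ⟶ Y :=
  homMk 0 (fun _ => 0) (fun _ => by rw [zero_comp, comp_zero])

lemma isStrictMono_zeroHom [HasZeroObject C] (X : FilteredObject C) :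
    IsStrictMono (zeroHom (zero C) X) := by
  refine ⟨⟨fun _ _ _ => (isZero_zero C).eq_of_tgt _ _⟩, fun i T x _ => ?_⟩
  exact (Subobject.mk_factors_iff _ _).2 ⟨x, Category.comp_id _⟩

end

section

variable {A : Type u} [Category.{v} A] [Abelian A] [HasDerivedCategory.{w} A]

open DerivedCategory.Plus

lemma isZero_Q_cone_fil (K : FilteredObject (CochainComplex.Plus A)) (i : EInt) :
    IsZero (Q.obj (K.cone.fil i : CochainComplex.Plus A)) :=
  (CochainComplex.Plus.isZero_Q_coneFunctor _).of_iso (Q.mapIso (K.coneFilIso i))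

/-- The second summand has trivial cohomology, and so have the steps of its filtration. -/
lemma quasiIso_fst_cone (K' K : FilteredObject (CochainComplex.Plus A)) :
    FilteredDerivedCategory.quasiIso A (fst K' K.cone) := by
  rw [quasiIso_iff_isIso_Q_map_filMap]
  intro i
  have hz : IsZero (Q.obj (K.cone.fil i : CochainComplex.Plus A)) := K.isZero_Q_cone_fil i
  have : IsIso (Q.map (biprod.fst : (K'.fil i : CochainComplex.Plus A) ⊞
      (K.cone.fil i : CochainComplex.Plus A) ⟶ _)) := by
    refine ⟨Q.map biprod.inl, ?_, ?_⟩
    · rw [← Functor.map_comp]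
      have h : Q.map (biprod.snd : (K'.fil i : CochainComplex.Plus A) ⊞
          (K.cone.fil i : CochainComplex.Plus A) ⟶ _) = 0 := hz.eq_of_tgt _ _
      have e := Q.congr_map (biprod.total (X := (K'.fil i : CochainComplex.Plus A))
        (Y := (K.cone.fil i : CochainComplex.Plus A)))
      rw [Functor.map_add, Functor.map_comp _ biprod.snd, h, zero_comp, add_zero] at e
      exact e.trans (CategoryTheory.Functor.map_id _ _)
    · rw [← Functor.map_comp, biprod.inl_fst, CategoryTheory.Functor.map_id]
  rw [filMap_fst, Functor.map_comp]
  infer_instance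

lemma isIso_Q_map_fst_cone (K' K : FilteredObject (CochainComplex.Plus A)) :
    IsIso ((FilteredDerivedCategory.quasiIso A).Q.map (fst K' K.cone)) :=
  (FilteredDerivedCategory.quasiIso A).Q_inverts _ (quasiIso_fst_cone K' K)

/-- A compatible family of morphisms in the derived category from the steps of the
filtration of a filtered complex to those of a filtered injective complex lifts to a
morphism of filtered complexes. -/
lemma exists_hom_of_compatible {Z I : FilteredObject (CochainComplex.Plus A)} (hI : I.IsInjective)
    (φ : ∀ i, Q.obj (Z.fil i : CochainComplex.Plus A) ⟶ Q.obj (I.fil i : CochainComplex.Plus A))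
    (hφ : ∀ i i' (h : i ≤ i'), φ i' ≫ Q.map (I.incl h) = Q.map (Z.incl h) ≫ φ i) :
    ∃ h : Z ⟶ I, ∀ i, Q.map (filMap h i) = φ i := by
  have hz (i : EInt) : IsZero ((zero (CochainComplex.Plus A)).fil i : CochainComplex.Plus A) :=
    (isZero_zero _).of_iso (Subobject.underlyingIso _)
  obtain ⟨h, -, hh⟩ := exists_hom_extension Z.isStrictMono_zeroHom hI (zeroHom _ _) φ hφ
    (fun i => (Functor.map_isZero Q (hz i)).eq_of_src _ _) (fun i α _ h₂ => by
      have hle : (i : EInt) ≤ ((i + 1 : ℤ) : EInt) := WithBotTop.coe_le_coe.2 (by lia)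
      have : IsIso ((zero (CochainComplex.Plus A)).incl hle) :=
        (hz _).isIso (hz _) _
      have : IsIso (pushout.inr ((zero (CochainComplex.Plus A)).incl hle)
        (filMap (zeroHom _ Z) ((i + 1 : ℤ) : EInt))) := inferInstance
      rw [← cancel_epi (Q.map (pushout.inr ((zero (CochainComplex.Plus A)).incl hle)
        (filMap (zeroHom _ Z) ((i + 1 : ℤ) : EInt)))), comp_zero]
      exact h₂)
  exact ⟨h, hh⟩

/-- Any morphism in the filtered derived category to a filtered injective complex is given by
a morphism of filtered complexes. The point is that morphisms to `I` extend along
strict monomorphisms `K ⟶ K'` that are filtered quasi-isomorphisms, and that a filtered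
quasi-isomorphism becomes a strict monomorphism after adding the cone of `K` to `K'`. -/
lemma exists_Q_map_eq {K I : FilteredObject (CochainComplex.Plus A)} (hI : I.IsInjective)
    (f : (FilteredDerivedCategory.quasiIso A).Q.obj K ⟶
      (FilteredDerivedCategory.quasiIso A).Q.obj I) :
    ∃ g : K ⟶ I, (FilteredDerivedCategory.quasiIso A).Q.map g = f := by
  let L := (FilteredDerivedCategory.quasiIso A).Q
  refine Localization.induction_costructuredArrow L (FilteredDerivedCategory.quasiIso A)
    (Y := I) (fun φ => ∃ g : φ.left ⟶ I, L.map g = φ.hom) ?_ ?_ ?_ (CostructuredArrow.mk f)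
  · exact ⟨𝟙 I, L.map_id I⟩
  · rintro X₁ X₂ f φ ⟨g, hg⟩
    exact ⟨f ≫ g, (L.map_comp f g).trans (congrArg (L.map f ≫ ·) hg)⟩
  · rintro K K' w hw φ ⟨g, hg⟩
    change K ⟶ I at g
    change L.map g = φ at hg
    -- `w` is replaced by the strict monomorphism `j` followed by the projection
    let j : K ⟶ biprod K' K.cone := lift w K.toCone
    have hj : IsStrictMono j := isStrictMono_lift w K.isStrictMono_toCone
    have hjw : j ≫ fst K' K.cone = w := lift_fst _ _
    have hw' := (quasiIso_iff_isIso_Q_map_filMap w).1 hw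
    have hp := (quasiIso_iff_isIso_Q_map_filMap _).1 (quasiIso_fst_cone K' K)
    have hj' (i : EInt) : IsIso (Q.map (filMap j i)) := by
      have := hw' i
      have := hp i
      have : IsIso (Q.map (filMap j i) ≫ Q.map (filMap (fst K' K.cone) i)) := by
        rwa [← Functor.map_comp, ← filMap_comp, hjw]
      exact IsIso.of_isIso_comp_right _ (Q.map (filMap (fst K' K.cone) i))
    obtain ⟨h, hh, -⟩ := exists_hom_extension hj hI g
      (fun i => inv (Q.map (filMap j i)) ≫ Q.map (filMap g i))
      (fun i i' hi => by
        rw [← cancel_epi (Q.map (filMap j i')), Category.assoc, IsIso.hom_inv_id_assoc,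
          ← Functor.map_comp, ← incl_filMap, ← Category.assoc, ← Functor.map_comp,
          ← incl_filMap, Functor.map_comp, Functor.map_comp, Category.assoc,
          IsIso.hom_inv_id_assoc])
      (fun i => IsIso.hom_inv_id_assoc _ _)
      (fun i α h₁ h₂ => by
        have := hj.mono_filMap ((i + 1 : ℤ) : EInt)
        exact pushout_hom_ext_of_isIso (IsPushout.of_hasPushout _ _) (hj' _) α h₁ h₂)
    let σ : K' ⟶ biprod K' K.cone := lift (𝟙 K') (zeroHom _ _)
    have hσ : L.map σ ≫ L.map (fst K' K.cone) = 𝟙 _ := by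
      rw [← L.map_comp, lift_fst, L.map_id]
    have : IsIso (L.map (fst K' K.cone)) := isIso_Q_map_fst_cone K' K
    have hσ' : L.map (fst K' K.cone) ≫ L.map σ = 𝟙 _ := by
      rw [← cancel_mono (L.map (fst K' K.cone)), Category.assoc, hσ, Category.comp_id,
        Category.id_comp]
    refine ⟨σ ≫ h, ?_⟩
    change L.map (σ ≫ h) = (Localization.isoOfHom L _ w hw).inv ≫ φ
    rw [Iso.eq_inv_comp, Localization.isoOfHom_hom, ← hg, ← hh, ← hjw, L.map_comp, L.map_comp,
      L.map_comp, Category.assoc, reassoc_of% hσ']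

/-- Under a vanishing assumption, two morphisms to a filtered injective complex which induce the
same morphisms in the derived category on the steps of the filtrations
are equal in the filtered derived category: their difference extends to the cone of `K`. -/
lemma Q_map_eq_of_Q_map_filMap_eq {K I : FilteredObject (CochainComplex.Plus A)}
    (hI : I.IsInjective)
    (hKI : ∀ (i : ℤ) (β : (Q.obj (K.fil ((i + 1 : ℤ) : EInt) : CochainComplex.Plus A))⟦(1 : ℤ)⟧ ⟶
      Q.obj (I.fil (i : EInt) : CochainComplex.Plus A)), β = 0)
    (f g : K ⟶ I) (hfg : ∀ i, Q.map (filMap f i) = Q.map (filMap g i)) :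
    (FilteredDerivedCategory.quasiIso A).Q.map f =
      (FilteredDerivedCategory.quasiIso A).Q.map g := by
  let L := (FilteredDerivedCategory.quasiIso A).Q
  obtain ⟨h, hh, -⟩ := exists_hom_extension K.isStrictMono_toCone hI (sub f g)
    (fun i => 0) (fun i i' hi => by rw [zero_comp, comp_zero])
    (fun i => by rw [comp_zero, filMap_sub, Functor.map_sub, hfg, sub_self])
    (fun i α h₁ h₂ => by
      have := K.isStrictMono_toCone.mono_filMap ((i + 1 : ℤ) : EInt)
      exact pushout_hom_ext_of_shift_zero (IsPushout.of_hasPushout _ _) (hKI i) α h₁ h₂)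
  -- `f` and `g` factor through the two sections `𝟙 + toCone` and `𝟙` of a filtered
  -- quasi-isomorphism
  let a : K ⟶ biprod K K.cone := lift (𝟙 K) K.toCone
  let b : K ⟶ biprod K K.cone := lift (𝟙 K) (zeroHom _ _)
  have ha : a ≫ desc g h = f := hom_ext (by
    have : Hom.hom K.toCone ≫ Hom.hom h = Hom.hom f - Hom.hom g := congrArg Hom.hom hh
    change biprod.lift (𝟙 _) (Hom.hom K.toCone) ≫ biprod.desc (Hom.hom g) (Hom.hom h) = _
    rw [biprod.lift_desc, Category.id_comp, this, add_sub_cancel])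
  have hb : b ≫ desc g h = g := hom_ext (by
    change biprod.lift (𝟙 _) 0 ≫ biprod.desc (Hom.hom g) (Hom.hom h) = _
    rw [biprod.lift_desc, Category.id_comp, zero_comp, add_zero])
  have : IsIso (L.map (fst K K.cone)) := isIso_Q_map_fst_cone K K
  have hab : L.map a = L.map b := by
    rw [← cancel_mono (L.map (fst K K.cone)), ← L.map_comp, ← L.map_comp, lift_fst, lift_fst]
  calc L.map f = L.map a ≫ L.map (desc g h) := by rw [← L.map_comp, ha]
    _ = L.map g := by rw [hab, ← L.map_comp, hb]

end

end FilteredObject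

/-! ### Distinguished triangles and the heart of a t-structure on a triangulated subcategory -/

section HeartOfSubcategory

open Pretriangulated Triangulated

variable {C : Type u} [Category.{v} C] [Preadditive C] [HasZeroObject C] [HasShift C ℤ]
  [∀ n : ℤ, (shiftFunctor C n).Additive] [Pretriangulated C]
  {P : ObjectProperty C} [P.IsTriangulated] (t : TStructure P.FullSubcategory)

lemma isLE_heart (X : t.heart.FullSubcategory) : t.IsLE X.obj 0 :=
  ((t.mem_heart_iff _).1 X.property).1

lemma isGE_heart (X : t.heart.FullSubcategory) : t.IsGE X.obj 0 :=
  ((t.mem_heart_iff _).1 X.property).2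

/-- There are no nonzero morphisms `X[1] ⟶ Y` between objects of the heart. As the heart belongs
to a full subcategory, this holds in the ambient category. -/
lemma heart_shift_hom_eq_zero {X Y : t.heart.FullSubcategory}
    (β : ((t.heart.ι ⋙ P.ι).obj X)⟦(1 : ℤ)⟧ ⟶ (t.heart.ι ⋙ P.ι).obj Y) : β = 0 := by
  have := isLE_heart t X
  have := isGE_heart t Y
  let γ : X.obj⟦(1 : ℤ)⟧ ⟶ Y.obj := P.ι.preimage ((P.ι.commShiftIso (1 : ℤ)).hom.app X.obj ≫ β)
  have hγ : γ = 0 := t.zero_of_isLE_of_isGE γ (-1) 0 (by lia)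
    (t.isLE_shift X.obj 0 1 (-1)) inferInstance
  rw [← cancel_epi ((P.ι.commShiftIso (1 : ℤ)).hom.app X.obj), comp_zero]
  exact (P.ι.map_preimage _).symm.trans ((P.ι.congr_map hγ).trans (P.ι.map_zero _ _))

lemma essImage_heart_shift_hom_eq_zero {M N : C} (hM : (t.heart.ι ⋙ P.ι).essImage M)
    (hN : (t.heart.ι ⋙ P.ι).essImage N) (β : M⟦(1 : ℤ)⟧ ⟶ N) : β = 0 := by
  obtain ⟨X, ⟨e⟩⟩ := hM
  obtain ⟨Y, ⟨e'⟩⟩ := hN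
  rw [← cancel_mono e'.inv, ← cancel_epi ((shiftFunctor C (1 : ℤ)).map e.hom)]
  exact (heart_shift_hom_eq_zero t _).trans (by rw [zero_comp, comp_zero])

lemma heart_map_eq_zero_iff {X Y : t.heart.FullSubcategory} (f : X ⟶ Y) :
    (t.heart.ι ⋙ P.ι).map f = 0 ↔ f = 0 :=
  Functor.map_eq_zero_iff _

section

variable {X₁ X₂ X₃ : t.heart.FullSubcategory} {f : X₁ ⟶ X₂} {g : X₂ ⟶ X₃}
  {δ : (t.heart.ι ⋙ P.ι).obj X₃ ⟶ ((t.heart.ι ⋙ P.ι).obj X₁)⟦(1 : ℤ)⟧}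

lemma mono_of_distTriang_heart
    (hT : Triangle.mk ((t.heart.ι ⋙ P.ι).map f) ((t.heart.ι ⋙ P.ι).map g) δ ∈ distTriang C) :
    Mono f := by
  refine Preadditive.mono_of_cancel_zero _ fun {W} x hx => ?_
  obtain ⟨y, hy⟩ := Triangle.coyoneda_exact₁ _ hT
    ((shiftFunctor C (1 : ℤ)).map ((t.heart.ι ⋙ P.ι).map x)) (by
      have : P.ι.map (t.heart.ι.map x) ≫ P.ι.map (t.heart.ι.map f) = 0 := by
        exact ((t.heart.ι ⋙ P.ι).map_comp x f).symm.trans ((heart_map_eq_zero_iff t _).2 hx)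
      exact ((shiftFunctor C (1 : ℤ)).map_comp _ _).symm.trans
        (((shiftFunctor C (1 : ℤ)).congr_map this).trans (Functor.map_zero _ _ _)))
  have hy₀ : y = 0 := heart_shift_hom_eq_zero t y
  rw [hy₀, zero_comp] at hy
  rw [← heart_map_eq_zero_iff t]
  exact (Functor.map_eq_zero_iff _).1 hy

lemma comp_eq_zero_of_distTriang_heart
    (hT : Triangle.mk ((t.heart.ι ⋙ P.ι).map f) ((t.heart.ι ⋙ P.ι).map g) δ ∈ distTriang C) :
    f ≫ g = 0 := by
  rw [← heart_map_eq_zero_iff t, Functor.map_comp]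
  exact comp_distTriang_mor_zero₁₂ _ hT

/-- A distinguished triangle whose three objects belong to the heart exhibits
the third object as the cokernel of the first morphism. -/
lemma isColimit_of_distTriang_heart
    (hT : Triangle.mk ((t.heart.ι ⋙ P.ι).map f) ((t.heart.ι ⋙ P.ι).map g) δ ∈ distTriang C) :
    Nonempty (IsColimit (CokernelCofork.ofπ g (comp_eq_zero_of_distTriang_heart t hT))) := by
  have hd {W : t.heart.FullSubcategory} (k : X₂ ⟶ W) (hk : f ≫ k = 0) :
      ∃ l : X₃ ⟶ W, g ≫ l = k := by
    obtain ⟨l, hl⟩ := Triangle.yoneda_exact₂ _ hT ((t.heart.ι ⋙ P.ι).map k) (by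
      exact ((t.heart.ι ⋙ P.ι).map_comp f k).symm.trans ((heart_map_eq_zero_iff t _).2 hk))
    change (t.heart.ι ⋙ P.ι).obj X₃ ⟶ (t.heart.ι ⋙ P.ι).obj W at l
    refine ⟨(t.heart.ι ⋙ P.ι).preimage l, (t.heart.ι ⋙ P.ι).map_injective ?_⟩
    rw [Functor.map_comp, Functor.map_preimage]
    exact hl.symm
  have : Epi g := by
    refine Preadditive.epi_of_cancel_zero _ fun {W} x hx => ?_
    obtain ⟨y, hy⟩ := Triangle.yoneda_exact₃ _ hT ((t.heart.ι ⋙ P.ι).map x) (by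
      exact ((t.heart.ι ⋙ P.ι).map_comp g x).symm.trans ((heart_map_eq_zero_iff t _).2 hx))
    have hy₀ : y = 0 := heart_shift_hom_eq_zero t y
    rw [hy₀, comp_zero] at hy
    exact (heart_map_eq_zero_iff t _).1 hy
  choose l hl using @hd
  exact ⟨CokernelCofork.IsColimit.ofπ' g _ (fun k hk => ⟨l k hk, hl k hk⟩)⟩

end

/-- The heart is stable by extensions in the ambient triangulated category. -/
lemma essImage_heart_of_distTriang {T : Triangle C} (hT : T ∈ distTriang C)
    (h₁ : (t.heart.ι ⋙ P.ι).essImage T.obj₁) (h₃ : (t.heart.ι ⋙ P.ι).essImage T.obj₃) :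
    (t.heart.ι ⋙ P.ι).essImage T.obj₂ := by
  obtain ⟨X, ⟨e⟩⟩ := h₁
  obtain ⟨Z, ⟨e'⟩⟩ := h₃
  obtain ⟨Y, hY, ⟨e''⟩⟩ := P.isoClosure.ext_of_isTriangulatedClosed₂ T hT
    ⟨_, X.obj.property, ⟨e.symm⟩⟩ ⟨_, Z.obj.property, ⟨e'.symm⟩⟩
  let Y' : P.FullSubcategory := ⟨Y, hY⟩
  let f : X.obj ⟶ Y' := P.ι.preimage (e.hom ≫ T.mor₁ ≫ e''.hom)
  let g : Y' ⟶ Z.obj := P.ι.preimage (e''.inv ≫ T.mor₂ ≫ e'.inv)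
  obtain ⟨δ', hδ'⟩ := P.exists_distTriang_fullSubcategory f g
    (e'.hom ≫ T.mor₃ ≫ (shiftFunctor C (1 : ℤ)).map e.inv) (by
      refine isomorphic_distinguished _ hT _ (Triangle.isoMk _ _ e e''.symm e' ?_ ?_ ?_)
      · change P.ι.map f ≫ e''.inv = e.hom ≫ T.mor₁
        rw [P.ι.map_preimage, Category.assoc, Category.assoc, e''.hom_inv_id, Category.comp_id]
      · change P.ι.map g ≫ e'.hom = e''.inv ≫ T.mor₂
        rw [P.ι.map_preimage, Category.assoc, Category.assoc, e'.inv_hom_id, Category.comp_id]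
      · change (e'.hom ≫ T.mor₃ ≫ (shiftFunctor C (1 : ℤ)).map e.inv) ≫
          (shiftFunctor C (1 : ℤ)).map e.hom = e'.hom ≫ T.mor₃
        rw [Category.assoc, Category.assoc, ← Functor.map_comp, e.inv_hom_id,
          CategoryTheory.Functor.map_id, Category.comp_id])
  exact ⟨⟨Y', (t.mem_heart_iff _).2 ⟨t.isLE₂ _ hδ' 0 (isLE_heart t X) (isLE_heart t Z),
    t.isGE₂ _ hδ' 0 (isGE_heart t X) (isGE_heart t Z)⟩⟩, ⟨e''.symm⟩⟩

/-- The cone of a monomorphism of the heart belongs to the heart: in the distinguished triangle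
`K[1] ⟶ cone f ⟶ Q` with `K` and `Q` in the heart, the object `K`, which is the kernel of `f`,
is zero. -/
lemma essImage_heart_of_mono {X₁ X₂ : t.heart.FullSubcategory} (f : X₁ ⟶ X₂) [Mono f]
    {T : Triangle C} (hT : T ∈ distTriang C) (e₁ : T.obj₁ ≅ (t.heart.ι ⋙ P.ι).obj X₁)
    (e₂ : T.obj₂ ≅ (t.heart.ι ⋙ P.ι).obj X₂)
    (comm : T.mor₁ ≫ e₂.hom = e₁.hom ≫ (t.heart.ι ⋙ P.ι).map f) :
    (t.heart.ι ⋙ P.ι).essImage T.obj₃ := by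
  have h₁ := isLE_heart t X₁
  have h₂ := isGE_heart t X₂
  obtain ⟨Z, g, δ, hZ⟩ := distinguished_cocone_triangle (t.heart.ι.map f)
  obtain ⟨K, Q, α, β, γ, h⟩ := admissibleMorphism_heart t f g δ hZ
  have hK := isLE_heart t K
  have hQ := isGE_heart t Q
  have hK₁ : t.IsLE ((t.heart.ι.obj K)⟦(1 : ℤ)⟧) (-1) := t.isLE_shift K.obj 0 1 (-1)
  have hK₂ : t.IsLE ((t.heart.ι.obj K)⟦(1 : ℤ)⟧⟦(1 : ℤ)⟧) (-2) := t.isLE_shift _ (-1) 1 (-2)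
  -- `α ≫ δ` is the shift of a morphism `K ⟶ X₁` that is killed by `f`
  have hα : α = 0 := by
    obtain ⟨k, hk⟩ := (shiftFunctor _ (1 : ℤ)).map_surjective (α ≫ δ)
    have hkf : k ≫ t.heart.ι.map f = 0 := by
      apply (shiftFunctor _ (1 : ℤ)).map_injective
      rw [Functor.map_comp, hk, Functor.map_zero, Category.assoc]
      have : δ ≫ (shiftFunctor _ (1 : ℤ)).map (t.heart.ι.map f) = 0 :=
        comp_distTriang_mor_zero₃₁ _ hZ
      rw [this, comp_zero]
    obtain ⟨k, rfl⟩ := t.heart.ι.map_surjective k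
    have hk₀ : k = 0 := by
      rw [← cancel_mono f, zero_comp]
      exact t.heart.ι.map_injective
        ((t.heart.ι.map_comp _ _).trans (hkf.trans (t.heart.ι.map_zero _ _).symm))
    rw [hk₀, Functor.map_zero, Functor.map_zero] at hk
    obtain ⟨y, hy⟩ := Triangle.coyoneda_exact₃ _ hZ α hk.symm
    rw [hy, t.zero_of_isLE_of_isGE y (-1) 0 (by lia) hK₁ h₂]
    exact zero_comp
  have hK₀ : IsZero ((t.heart.ι.obj K)⟦(1 : ℤ)⟧) := by
    obtain ⟨s, hs⟩ := Triangle.coyoneda_exact₁ _ h (𝟙 _)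
      ((Category.id_comp _).trans
        (((shiftFunctor _ (1 : ℤ)).congr_map hα).trans (Functor.map_zero _ _ _)))
    have hs₀ : s = 0 := t.zero_of_isLE_of_isGE s (-2) 0 (by lia) hK₂ hQ
    rw [hs₀, zero_comp] at hs
    rw [IsZero.iff_id_eq_zero]
    apply (shiftFunctor _ (1 : ℤ)).map_injective
    rw [Functor.map_zero]
    exact (CategoryTheory.Functor.map_id _ _).trans hs
  have : IsIso β := (Triangle.isZero₁_iff_isIso₂ _ h).1 hK₀
  exact ⟨Q, ⟨P.ι.mapIso (asIso β).symm ≪≫ (Triangle.π₃.mapIso (isoTriangleOfIso₁₂ _ _ hT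
    (P.ι.map_distinguished _ hZ) e₁ e₂ comm)).symm⟩⟩

end HeartOfSubcategory

/-! ### Filtered injective complexes representing a finite filtration -/

section InjectiveSequences

variable {A : Type u} [Category.{v} A] [Abelian A] [EnoughInjectives A]

open HomotopicalAlgebra CochainComplex.Plus.modelCategoryQuillen in
/-- A morphism to a bounded below complex of injectives factors as a monomorphism to a bounded
below complex of injectives followed by a quasi-isomorphism: this is the factorization as a
cofibration followed by a trivial fibration in the model category of bounded below complexes. -/
lemma exists_mono_factorization [HasDerivedCategory.{w} A] {K J : CochainComplex.Plus A}
    (f : K ⟶ J) (hJ : ∀ n, Injective (J.obj.X n)) :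
    ∃ (Z : CochainComplex.Plus A) (i : K ⟶ Z) (p : Z ⟶ J), (∀ n, Injective (Z.obj.X n)) ∧
      Mono i ∧ IsIso (DerivedCategory.Plus.Q.map p) ∧ i ≫ p = f := by
  have hJ' : IsFibrant J := (CochainComplex.Plus.modelCategoryQuillen.isFibrant_iff J).2 hJ
  let d := MorphismProperty.factorizationData (cofibrations (CochainComplex.Plus A))
    (trivialFibrations (CochainComplex.Plus A)) f
  have : IsFibrant d.Z := isFibrant_of_fibration d.p
  exact ⟨d.Z, d.i, d.p, (CochainComplex.Plus.modelCategoryQuillen.isFibrant_iff _).1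
    inferInstance, inferInstance,
    FilteredDerivedCategory.isIso_Q_map _ ((HomotopicalAlgebra.weakEquivalence_iff d.p).1
      inferInstance), d.fac⟩

variable [HasDerivedCategory.{w} A]

open DerivedCategory.Plus

/-- Any morphism `Q K ⟶ M` in the derived category is represented by a monomorphism from `K` to
a bounded below complex of injectives. -/
lemma exists_mono_to_injective (K : CochainComplex.Plus A) {M : DerivedCategory.Plus A}
    (φ : Q.obj K ⟶ M) :
    ∃ (Z : CochainComplex.Plus A) (i : K ⟶ Z) (e : Q.obj Z ≅ M),
      (∀ n, Injective (Z.obj.X n)) ∧ Mono i ∧ Q.map i ≫ e.hom = φ := by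
  obtain ⟨n, hn⟩ : ∃ n, M.IsGE n := by
    obtain ⟨n, hn⟩ := M.property
    exact ⟨n, (isGE_ι_obj_iff M n).1 hn⟩
  obtain ⟨J', -, ⟨e⟩⟩ := DerivedCategory.Plus.exists_injective_nonempty_iso M n
  let J := (InjectiveObject.ι A).mapCochainComplexPlus.obj J'
  have hJ (n : ℤ) : Injective (J.obj.X n) := (J'.obj.X n).property
  have hz := isZero_zero (CochainComplex.Plus A)
  have : Mono (hz.to_ K) := ⟨fun _ _ _ => hz.eq_of_tgt _ _⟩
  obtain ⟨f, -, hf⟩ := exists_extension (hz.to_ K) hJ (hz.to_ J) (φ ≫ e.inv)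
    ((Functor.map_isZero Q hz).eq_of_src _ _)
  obtain ⟨Z, i, p, hZ, hi, hp, fac⟩ := exists_mono_factorization f hJ
  refine ⟨Z, i, asIso (Q.map p) ≪≫ e, hZ, hi, ?_⟩
  rw [Iso.trans_hom, asIso_hom, ← Category.assoc, ← Functor.map_comp, fac, hf, Category.assoc,
    e.inv_hom_id, Category.comp_id]

/-- Any sequence in the derived category starting with a zero object
is represented by a sequence of monomorphisms between bounded below complexes of injectives. -/
lemma exists_injective_sequence (M : ℕ ⥤ DerivedCategory.Plus A) (hM : IsZero (M.obj 0)) :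
    ∃ (Z : ℕ ⥤ CochainComplex.Plus A), IsZero (Z.obj 0) ∧
      (∀ n k, Injective ((Z.obj n).obj.X k)) ∧ (∀ n m (h : n ≤ m), Mono (Z.map (homOfLE h))) ∧
      Nonempty (Z ⋙ Q ≅ M) := by
  let T (n : ℕ) := { p : Σ Z : CochainComplex.Plus A, (Q.obj Z ≅ M.obj n) //
    ∀ k, Injective (p.1.obj.X k) }
  have step (n : ℕ) (p : T n) : ∃ (q : T (n + 1)) (i : p.1.1 ⟶ q.1.1), Mono i ∧
      Q.map i ≫ q.1.2.hom = p.1.2.hom ≫ M.map (homOfLE (Nat.le_add_right n 1)) := by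
    obtain ⟨Z, i, e, hZ, hi, fac⟩ := exists_mono_to_injective p.1.1
      (p.1.2.hom ≫ M.map (homOfLE (Nat.le_add_right n 1)))
    exact ⟨⟨⟨Z, e⟩, hZ⟩, i, hi, fac⟩
  choose nx i hi hi' using step
  open ZeroObject in
  let p₀ : T 0 := ⟨⟨0, (Functor.map_isZero Q (isZero_zero _)).iso hM⟩, fun k =>
    (Functor.map_isZero (CochainComplex.Plus.ι A ⋙ HomologicalComplex.eval _ _ k)
      (isZero_zero _)).injective⟩
  let s (n : ℕ) : T n := Nat.rec p₀ nx n
  let Z := Functor.ofSequence (X := fun n => (s n).1.1) (fun n => i n (s n))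
  have hZ (n : ℕ) : Z.map (homOfLE (Nat.le_add_right n 1)) = i n (s n) :=
    Functor.ofSequence_map_homOfLE_succ _ n
  let α : Z ⋙ Q ⟶ M := NatTrans.ofSequence (fun n => (s n).1.2.hom) (fun n => by
    change Q.map (Z.map _) ≫ _ = _
    rw [hZ]
    exact hi' n (s n))
  have : IsIso α := by
    have (n : ℕ) : IsIso (α.app n) := inferInstanceAs (IsIso (s n).1.2.hom)
    exact NatIso.isIso_of_isIso_app _
  refine ⟨Z, isZero_zero _, fun n => (s n).2, fun n m h => ?_, ⟨asIso α⟩⟩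
  induction m, h using Nat.le_induction with
  | base => exact inferInstanceAs (Mono (Z.map (𝟙 n)))
  | succ m h hm =>
    have hm' : Mono (Z.map (homOfLE (Nat.le_add_right m 1))) := by
      rw [hZ]
      exact hi m (s m)
    have : Z.map (homOfLE (h.trans (Nat.le_add_right m 1))) =
        Z.map (homOfLE h) ≫ Z.map (homOfLE (Nat.le_add_right m 1)) := by
      rw [← Functor.map_comp]
      rfl
    rw [this]
    exact mono_comp _ _

end InjectiveSequences

namespace FilteredObject

/-- The integer of the interval `[a, b]` that is nearest to an element of `[-∞, +∞]`. -/
def clip (a b : ℤ) : EInt → ℤ :=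
  WithBotTop.rec a (fun k => max a (min k b)) b

lemma clip_mono {a b : ℤ} (hab : a ≤ b) {i j : EInt} (h : i ≤ j) :
    clip a b i ≤ clip a b j := by
  induction i using WithBotTop.rec with
  | bot =>
    induction j using WithBotTop.rec with
    | bot => exact le_rfl
    | coe j => exact le_max_left _ _
    | top => exact hab
  | coe i =>
    induction j using WithBotTop.rec with
    | bot => exact absurd (le_bot_iff.1 h) (WithBotTop.coe_ne_bot i)
    | coe j =>
      have := WithBotTop.coe_le_coe.1 h
      change max a (min i b) ≤ max a (min j b)
      lia
    | top =>
      change max a (min i b) ≤ b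
      lia
  | top =>
    obtain rfl := top_le_iff.1 h
    exact le_rfl

lemma le_clip {a b : ℤ} (hab : a ≤ b) (i : EInt) : a ≤ clip a b i := clip_mono hab bot_le

lemma clip_le {a b : ℤ} (hab : a ≤ b) (i : EInt) : clip a b i ≤ b := clip_mono hab le_top

lemma clip_of_le {a b : ℤ} (hab : a ≤ b) {i : EInt} (h : i ≤ (a : EInt)) : clip a b i = a := by
  refine le_antisymm ((clip_mono hab h).trans ?_) (le_clip hab i)
  change max a (min a b) ≤ a
  lia

lemma clip_of_ge {a b : ℤ} (hab : a ≤ b) {i : EInt} (h : (b : EInt) ≤ i) : clip a b i = b := by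
  refine le_antisymm (clip_le hab i) (le_trans ?_ (clip_mono hab h))
  change b ≤ max a (min b b)
  lia

/-- A finite filtration is determined by its steps in a bounded interval of `ℤ`. -/
lemma exists_fil_clip_eq {C : Type u} [Category.{v} C] (X : FilteredObject C) :
    ∃ (a b : ℤ) (_ : a ≤ b), ∀ i, X.fil (clip a b i : EInt) = X.fil i := by
  obtain ⟨a, ha⟩ := X.exists_fil_eq_bot
  obtain ⟨b, hb⟩ := X.exists_fil_eq_top
  have ha' {i : EInt} (hi : i ≤ (a : EInt)) : X.fil i = X.fil ⊥ :=
    le_antisymm (X.antitone_fil bot_le) (ha.ge.trans (X.antitone_fil hi))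
  have hb' {i : EInt} (hi : ((max a b : ℤ) : EInt) ≤ i) : X.fil i = X.fil ⊤ :=
    le_antisymm ((X.antitone_fil (le_trans (WithBotTop.coe_le_coe.2 (le_max_right a b)) hi)).trans
      hb.le) (X.antitone_fil le_top)
  refine ⟨a, max a b, le_max_left _ _, fun i => ?_⟩
  induction i using WithBotTop.rec with
  | bot => exact ha' le_rfl
  | coe i =>
    obtain h | h := le_total i a
    · have h' := WithBotTop.coe_le_coe.2 h
      rw [clip_of_le (le_max_left _ _) h', ha' h', ha' le_rfl]
    · obtain h₁ | h₁ := le_total (max a b) i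
      · have h' := WithBotTop.coe_le_coe.2 h₁
        rw [clip_of_ge (le_max_left _ _) h', hb' h', hb' le_rfl]
      · congr 2
        change max a (min i (max a b)) = i
        lia
  | top => exact hb' le_rfl

section

variable {C : Type*} [Category* C] (X : FilteredObject C)

/-- The steps `Fil^b X ⟶ Fil^{b-1} X ⟶ ⋯` of the filtration, as a sequence. -/
noncomputable def filSequence (b : ℤ) : ℕ ⥤ C where
  obj n := (X.fil ((b - n : ℤ) : EInt) : C)
  map {n m} f := X.incl (WithBotTop.coe_le_coe.2 (by have := leOfHom f; lia))
  map_id n := X.incl_refl _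
  map_comp f g := (X.incl_comp_incl _ _).symm

end

variable {A : Type u} [Category.{v} A] [Abelian A] [EnoughInjectives A] [HasDerivedCategory.{w} A]

open DerivedCategory.Plus

/-- The steps of any finite filtration are represented in the derived category by those
of a filtered injective complex. (The category `C` does not need to be related to complexes:
only the sequence of the steps matters.) -/
lemma exists_isInjective {C : Type*} [Category* C] [HasZeroMorphisms C]
    (H : C ⥤ DerivedCategory.Plus A) [H.PreservesZeroMorphisms] (X : FilteredObject C) :
    ∃ (I : FilteredObject (CochainComplex.Plus A)) (_ : I.IsInjective)
      (ε : ∀ i, Q.obj (I.fil i : CochainComplex.Plus A) ≅ H.obj (X.fil i : C)),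
      ∀ i j (h : i ≤ j), Q.map (I.incl h) ≫ (ε i).hom = (ε j).hom ≫ H.map (X.incl h) := by
  obtain ⟨a, b, hab, hX⟩ := X.exists_fil_clip_eq
  have hXb : IsZero (X.fil (b : EInt) : C) := by
    rw [show X.fil (b : EInt) = X.fil ⊤ from hX ⊤]
    exact X.isZero_fil_top
  obtain ⟨Z, hZ₀, hZ, hm, ⟨e⟩⟩ := exists_injective_sequence (X.filSequence b ⋙ H)
    (H.map_isZero (by
      change IsZero (X.fil ((b - (0 : ℕ) : ℤ) : EInt) : C)
      rwa [Nat.cast_zero, sub_zero]))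
  -- the position of `Fil^i` in the sequence `Fil^b ⟶ Fil^{b-1} ⟶ ⋯ ⟶ Fil^a`
  let c (i : EInt) : ℕ := (b - clip a b i).toNat
  have hc (i : EInt) : (b - c i : ℤ) = clip a b i := by
    have := clip_le hab i
    lia
  have hc' {i j : EInt} (h : i ≤ j) : c j ≤ c i := by
    have := clip_mono hab h
    lia
  let N := (b - a).toNat
  have hcN (i : EInt) : c i ≤ N := by
    have := le_clip hab i
    lia
  let I : FilteredObject (CochainComplex.Plus A) :=
    ofMono (Z.obj N) (fun i => Z.obj (c i)) (fun i => Z.map (homOfLE (hcN i)))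
      (fun i j h => ⟨Z.map (homOfLE (hc' h)), by rw [← Functor.map_comp]; rfl⟩)
      ⟨a, fun i hi => by
        have hi' : N ≤ c i := by
          have := clip_of_le hab hi
          lia
        have : IsIso (homOfLE (hcN i)) := ⟨homOfLE hi', rfl, rfl⟩
        infer_instance⟩
      ⟨b, fun i hi => by
        have hi' : c i = 0 := by
          have := clip_of_ge hab hi
          lia
        rwa [hi']⟩
  have hXc (i : EInt) : X.fil ((b - c i : ℤ) : EInt) = X.fil i := by rw [hc, hX]
  let ι (i : EInt) : (I.fil i : CochainComplex.Plus A) ≅ Z.obj (c i) := ofMonoFilIso _ _ _ _ _ _ i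
  have hι {i j : EInt} (h : i ≤ j) :
      I.incl h ≫ (ι i).hom = (ι j).hom ≫ Z.map (homOfLE (hc' h)) := by
    rw [← cancel_mono (Z.map (homOfLE (hcN i))), Category.assoc, Category.assoc,
      ofMonoFilIso_hom_comp, incl_arrow, ← Functor.map_comp]
    exact (ofMonoFilIso_hom_comp _ _ _ _ _ _ j).symm
  let μ (i : EInt) : (X.filSequence b).obj (c i) ≅ (X.fil i : C) :=
    Subobject.isoOfEq _ _ (hXc i)
  have hμ {i j : EInt} (h : i ≤ j) : (X.filSequence b).map (homOfLE (hc' h)) ≫ (μ i).hom =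
      (μ j).hom ≫ X.incl h :=
    (Subobject.ofLE_comp_ofLE _ _ _ _ _).trans (Subobject.ofLE_comp_ofLE _ _ _ _ _).symm
  refine ⟨I, fun i n => ?_, fun i => Q.mapIso (ι i) ≪≫ e.app (c i) ≪≫ H.mapIso (μ i),
    fun i j h => ?_⟩
  · have := hZ (c i) n
    exact Injective.of_iso ((CochainComplex.Plus.ι A ⋙ HomologicalComplex.eval _ _ n).mapIso
      (ι i).symm) this
  · have h₁ : Q.map (I.incl h) ≫ Q.map (ι i).hom =
        Q.map (ι j).hom ≫ Q.map (Z.map (homOfLE (hc' h))) := by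
      rw [← Functor.map_comp, hι, Functor.map_comp]
    have h₂ : Q.map (Z.map (homOfLE (hc' h))) ≫ e.hom.app (c i) =
        e.hom.app (c j) ≫ H.map ((X.filSequence b).map (homOfLE (hc' h))) :=
      e.hom.naturality (homOfLE (hc' h))
    have h₃ : H.map ((X.filSequence b).map (homOfLE (hc' h))) ≫ H.map (μ i).hom =
        H.map (μ j).hom ≫ H.map (X.incl h) := by
      rw [← H.map_comp, hμ, H.map_comp]
    change Q.map (I.incl h) ≫ Q.map (ι i).hom ≫ e.hom.app (c i) ≫ H.map (μ i).hom =
      (Q.map (ι j).hom ≫ e.hom.app (c j) ≫ H.map (μ j).hom) ≫ H.map (X.incl h)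
    rw [← Category.assoc, h₁, Category.assoc, ← Category.assoc (Q.map (Z.map _)), h₂,
      Category.assoc, h₃, Category.assoc, Category.assoc]

end FilteredObject

/-! ### The functors `Fil^i/Fil^j` on the filtered derived category -/

namespace FilteredDerivedCategory

section

variable {A : Type u} [Category.{v} A] [Abelian A] [HasDerivedCategory.{w} A]

open DerivedCategory.Plus Pretriangulated

/-- The functors `Fil^i/Fil^j` on the filtered derived category are computed at the level of
filtered complexes. -/
noncomputable def quotIso (i j : EInt) (h : i ≤ j) (K : FilteredObject (CochainComplex.Plus A)) :
    (quot i j h).obj ((quasiIso A).Q.obj K) ≅ Q.obj ((FilteredObject.quot i j h).obj K) :=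
  (Localization.Lifting.iso (quasiIso A).Q (quasiIso A)
    (FilteredObject.quot i j h ⋙ Q) (quot i j h)).app K

lemma quot_map_quotIso (i j : EInt) (h : i ≤ j) {K L : FilteredObject (CochainComplex.Plus A)}
    (f : K ⟶ L) :
    (quot i j h).map ((quasiIso A).Q.map f) ≫ (quotIso i j h L).hom =
      (quotIso i j h K).hom ≫ Q.map ((FilteredObject.quot i j h).map f) :=
  (Localization.Lifting.iso (quasiIso A).Q (quasiIso A)
    (FilteredObject.quot i j h ⋙ Q) (quot i j h)).hom.naturality f

lemma quotMap_app_quotIso {i j i' j' : EInt} (h : i ≤ j) (h' : i' ≤ j')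
    (hi : i ≤ i') (hj : j ≤ j') (K : FilteredObject (CochainComplex.Plus A)) :
    (quotMap h h' hi hj).app ((quasiIso A).Q.obj K) ≫ (quotIso i j h K).hom =
      (quotIso i' j' h' K).hom ≫ Q.map ((FilteredObject.quotMap h h' hi hj).app K) := by
  rw [quotMap, Localization.liftNatTrans_app]
  change ((quotIso i' j' h' K).hom ≫ Q.map ((FilteredObject.quotMap h h' hi hj).app K) ≫
    (quotIso i j h K).inv) ≫ (quotIso i j h K).hom = _
  rw [Category.assoc, Category.assoc, Iso.inv_hom_id, Category.comp_id]

omit [HasDerivedCategory.{w} A] in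
lemma exists_Q_obj_eq (X : Plus A) :
    ∃ K : FilteredObject (CochainComplex.Plus A), (quasiIso A).Q.obj K = X :=
  (Localization.Construction.objEquiv (quasiIso A)).surjective X

lemma quotMap_comp {i j i' j' i'' j'' : EInt} (h : i ≤ j) (h' : i' ≤ j') (h'' : i'' ≤ j'')
    (hi : i ≤ i') (hj : j ≤ j') (hi' : i' ≤ i'') (hj' : j' ≤ j'') (X : Plus A) :
    (quotMap h' h'' hi' hj').app X ≫ (quotMap h h' hi hj).app X =
      (quotMap h h'' (hi.trans hi') (hj.trans hj')).app X := by
  obtain ⟨K, rfl⟩ := exists_Q_obj_eq X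
  have hK : (FilteredObject.quotMap h' h'' hi' hj').app K ≫
      (FilteredObject.quotMap h h' hi hj).app K =
      (FilteredObject.quotMap h h'' (hi.trans hi') (hj.trans hj')).app K := by
    rw [← cancel_epi (K.proj h'')]
    change K.proj h'' ≫ K.quotMapApp h' h'' hi' hj' ≫ K.quotMapApp h h' hi hj =
      K.proj h'' ≫ K.quotMapApp h h'' (hi.trans hi') (hj.trans hj')
    rw [FilteredObject.proj_quotMapApp, ← Category.assoc, FilteredObject.proj_quotMapApp,
      Category.assoc, FilteredObject.proj_quotMapApp, ← Category.assoc,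
      FilteredObject.incl_comp_incl]
  rw [← cancel_mono (quotIso i j h K).hom, Category.assoc, quotMap_app_quotIso,
    quotMap_app_quotIso, ← Category.assoc, quotMap_app_quotIso, Category.assoc, ← Functor.map_comp,
    hK]

/-- For `i ≤ j ≤ k`, the distinguished triangle `Fil^j/Fil^k ⟶ Fil^i/Fil^k ⟶ Fil^i/Fil^j`. -/
lemma exists_distTriang_quot {i j k : EInt} (h : i ≤ j) (h' : j ≤ k) (X : Plus A) :
    ∃ (δ : (quot i j h).obj X ⟶ ((quot j k h').obj X)⟦(1 : ℤ)⟧),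
      Triangle.mk ((quotMap (h.trans h') h' h le_rfl).app X)
        ((quotMap h (h.trans h') le_rfl h').app X) δ ∈ distTriang (DerivedCategory.Plus A) := by
  obtain ⟨K, rfl⟩ := exists_Q_obj_eq X
  obtain ⟨δ, hδ⟩ : ∃ (δ : Q.obj ((FilteredObject.quot i j h).obj K) ⟶
      (Q.obj ((FilteredObject.quot j k h').obj K))⟦(1 : ℤ)⟧),
      Triangle.mk (Q.map ((FilteredObject.quotMap (h.trans h') h' h le_rfl).app K))
        (Q.map ((FilteredObject.quotMap h (h.trans h') le_rfl h').app K)) δ ∈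
        distTriang (DerivedCategory.Plus A) :=
    exists_distTriang_of_shortExact _ (quotSequence_shortExact h h' K)
  refine ⟨(quotIso i j h K).hom ≫ δ ≫ (shiftFunctor _ (1 : ℤ)).map (quotIso j k h' K).inv,
    isomorphic_distinguished _ hδ _ (Triangle.isoMk _ _ (quotIso j k h' K)
      (quotIso i k (h.trans h') K) (quotIso i j h K) ?_ ?_ ?_)⟩
  · exact quotMap_app_quotIso _ _ _ _ K
  · exact quotMap_app_quotIso _ _ _ _ K
  · change ((quotIso i j h K).hom ≫ δ ≫ (shiftFunctor _ (1 : ℤ)).map (quotIso j k h' K).inv) ≫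
      (shiftFunctor _ (1 : ℤ)).map (quotIso j k h' K).hom = (quotIso i j h K).hom ≫ δ
    rw [Category.assoc, Category.assoc, ← Functor.map_comp, Iso.inv_hom_id,
      CategoryTheory.Functor.map_id, Category.comp_id]

/-- The steps of the filtration compute the functors `Fil^i/Fil^{+∞}`. -/
noncomputable def filIso (i : EInt) (K : FilteredObject (CochainComplex.Plus A)) :
    Q.obj (K.fil i : CochainComplex.Plus A) ≅
      (quot i ⊤ le_top).obj ((quasiIso A).Q.obj K) :=
  have := K.isIso_proj_top i
  Q.mapIso (asIso (K.proj le_top)) ≪≫ (quotIso i ⊤ le_top K).symm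

lemma filIso_naturality (i : EInt) {K L : FilteredObject (CochainComplex.Plus A)} (f : K ⟶ L) :
    Q.map (FilteredObject.filMap f i) ≫ (filIso i L).hom =
      (filIso i K).hom ≫ (quot i ⊤ le_top).map ((quasiIso A).Q.map f) := by
  rw [← cancel_mono (quotIso i ⊤ le_top L).hom, Category.assoc, Category.assoc, quot_map_quotIso]
  dsimp only [filIso, Iso.trans_hom, Iso.symm_hom, Functor.mapIso_hom, asIso_hom]
  rw [Category.assoc, Iso.inv_hom_id, Category.comp_id, Category.assoc, Iso.inv_hom_id_assoc,
    ← Functor.map_comp, ← Functor.map_comp, FilteredObject.proj_quot_map]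

lemma incl_filIso {i j : EInt} (h : i ≤ j) (K : FilteredObject (CochainComplex.Plus A)) :
    Q.map (K.incl h) ≫ (filIso i K).hom =
      (filIso j K).hom ≫ (quotMap le_top le_top h le_rfl).app ((quasiIso A).Q.obj K) := by
  rw [← cancel_mono (quotIso i ⊤ le_top K).hom, Category.assoc, Category.assoc,
    quotMap_app_quotIso]
  dsimp only [filIso, Iso.trans_hom, Iso.symm_hom, Functor.mapIso_hom, asIso_hom]
  rw [Category.assoc, Iso.inv_hom_id, Category.comp_id, Category.assoc, Iso.inv_hom_id_assoc,
    ← Functor.map_comp, ← Functor.map_comp]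
  exact Q.congr_map (K.proj_quotMapApp le_top le_top h le_rfl).symm

end

end FilteredDerivedCategory

/-! ### The filtered object of the heart attached to an object of the filtered derived category -/

namespace FilteredDerivedCategory

variable {A : Type u} [Category.{v} A] [Abelian A] [HasDerivedCategory.{w} A]
  {P : ObjectProperty (DerivedCategory.Plus A)} [P.IsTriangulated]
  (t : Triangulated.TStructure P.FullSubcategory)

open DerivedCategory.Plus Pretriangulated

open ZeroObject in
lemma essImage_heartι_of_isZero {M : DerivedCategory.Plus A} (hM : IsZero M) :
    (heartι P t).essImage M := by
  have hz : IsZero (0 : P.FullSubcategory) := isZero_zero _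
  exact ⟨⟨0, (t.mem_heart_iff _).2 ⟨t.isLE_of_isZero hz 0, t.isGE_of_isZero hz 0⟩⟩,
    ⟨(P.ι.map_isZero hz).iso hM⟩⟩

variable {t} in
/-- If the graded pieces of `X` belong to the heart, then so do all the `Fil^i/Fil^j`, as
iterated extensions of graded pieces. -/
lemma essImage_quot_obj {X : Plus A} (hX : grMemHeart P t X) (i j : EInt) (h : i ≤ j) :
    (heartι P t).essImage ((quot i j h).obj X) := by
  have hfin (n : ℕ) : ∀ (i j : ℤ) (_ : j = i + n) (h : (i : EInt) ≤ (j : EInt)),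
      (heartι P t).essImage ((quot (i : EInt) (j : EInt) h).obj X) := by
    induction n with
    | zero =>
      intro i j hj h
      obtain rfl : j = i := by simpa using hj
      obtain ⟨K, rfl⟩ := exists_Q_obj_eq X
      exact essImage_heartι_of_isZero t
        ((Q.map_isZero (K.isZero_quot_self _)).of_iso (quotIso _ _ _ K))
    | succ n hn =>
      intro i j hj h
      obtain rfl : j = i + n + 1 := by rw [hj]; push_cast; ring
      have h₁ : (i : EInt) ≤ ((i + n : ℤ) : EInt) := WithBotTop.coe_le_coe.2 (by lia)
      have h₂ : ((i + n : ℤ) : EInt) ≤ ((i + n + 1 : ℤ) : EInt) :=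
        WithBotTop.coe_le_coe.2 (by lia)
      obtain ⟨δ, hδ⟩ := exists_distTriang_quot h₁ h₂ X
      exact essImage_heart_of_distTriang t hδ (hX.2 (i + n)) (hn _ _ rfl h₁)
  obtain ⟨K, rfl⟩ := exists_Q_obj_eq X
  obtain ⟨a, b, hab, hc⟩ := K.exists_fil_clip_eq
  have hij := FilteredObject.clip_mono hab h
  obtain ⟨n, hn⟩ := Int.le.dest hij
  obtain ⟨e⟩ := K.nonempty_quot_iso_of_eq (WithBotTop.coe_le_coe.2 hij) h (hc i) (hc j)
  exact (hfin n _ _ hn.symm (WithBotTop.coe_le_coe.2 hij)).ofIso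
    (quotIso _ _ _ K ≪≫ Q.mapIso e ≪≫ (quotIso _ _ _ K).symm)

variable (P) in
/-- The functor `Fil^i/Fil^j` with values in the heart, on the objects whose graded pieces
belong to the heart. -/
noncomputable abbrev heartQuot (i j : EInt) (h : i ≤ j) :
    (grMemHeart P t).FullSubcategory ⥤ t.heart.FullSubcategory :=
  Functor.essImage.liftFunctor ((grMemHeart P t).ι ⋙ quot i j h) (heartι P t)
    (fun X => essImage_quot_obj X.property i j h)

/-- The functor `heartQuot` is a lift to the heart of the functor `Fil^i/Fil^j`. -/
noncomputable def heartQuotIso (i j : EInt) (h : i ≤ j) :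
    heartQuot P t i j h ⋙ heartι P t ≅ (grMemHeart P t).ι ⋙ quot i j h :=
  Functor.essImage.liftFunctorCompIso _ _ _

/-- The natural transformation `Fil^{i'}/Fil^{j'} ⟶ Fil^i/Fil^j` for `i ≤ i'` and `j ≤ j'`,
for functors with values in the heart. -/
noncomputable def heartQuotMap {i j i' j' : EInt} (h : i ≤ j) (h' : i' ≤ j')
    (hi : i ≤ i') (hj : j ≤ j') : heartQuot P t i' j' h' ⟶ heartQuot P t i j h :=
  ((Functor.FullyFaithful.ofFullyFaithful (heartι P t)).whiskeringRight _).preimage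
    ((heartQuotIso t i' j' h').hom ≫
      Functor.whiskerLeft (grMemHeart P t).ι (quotMap h h' hi hj) ≫ (heartQuotIso t i j h).inv)

lemma heartQuotMap_app_heartQuotIso {i j i' j' : EInt} (h : i ≤ j) (h' : i' ≤ j')
    (hi : i ≤ i') (hj : j ≤ j') (X : (grMemHeart P t).FullSubcategory) :
    (heartι P t).map ((heartQuotMap t h h' hi hj).app X) ≫ (heartQuotIso t i j h).hom.app X =
      (heartQuotIso t i' j' h').hom.app X ≫ (quotMap h h' hi hj).app X.obj := by
  have e : (heartι P t).map ((heartQuotMap t h h' hi hj).app X) =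
      (heartQuotIso t i' j' h').hom.app X ≫ (quotMap h h' hi hj).app X.obj ≫
        (heartQuotIso t i j h).inv.app X :=
    congr_app (((Functor.FullyFaithful.ofFullyFaithful (heartι P t)).whiskeringRight
      (grMemHeart P t).FullSubcategory).map_preimage _) X
  rw [e, Category.assoc, Category.assoc, Iso.inv_hom_id_app]
  exact congrArg _ (Category.comp_id _)

lemma heartQuot_map_heartQuotIso (i j : EInt) (h : i ≤ j)
    {X Y : (grMemHeart P t).FullSubcategory} (f : X ⟶ Y) :
    (heartι P t).map ((heartQuot P t i j h).map f) ≫ (heartQuotIso t i j h).hom.app Y =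
      (heartQuotIso t i j h).hom.app X ≫ (quot i j h).map f.hom :=
  (heartQuotIso t i j h).hom.naturality f

lemma heartQuotMap_comp {i j i' j' i'' j'' : EInt} (h : i ≤ j) (h' : i' ≤ j') (h'' : i'' ≤ j'')
    (hi : i ≤ i') (hj : j ≤ j') (hi' : i' ≤ i'') (hj' : j' ≤ j'')
    (X : (grMemHeart P t).FullSubcategory) :
    (heartQuotMap t h' h'' hi' hj').app X ≫ (heartQuotMap t h h' hi hj).app X =
      (heartQuotMap t h h'' (hi.trans hi') (hj.trans hj')).app X := by
  apply (heartι P t).map_injective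
  rw [← cancel_mono ((heartQuotIso t i j h).hom.app X), Functor.map_comp, Category.assoc,
    heartQuotMap_app_heartQuotIso, ← Category.assoc, heartQuotMap_app_heartQuotIso,
    Category.assoc, quotMap_comp, heartQuotMap_app_heartQuotIso]

/-- For `i ≤ j ≤ k`, the sequence `Fil^j/Fil^k ⟶ Fil^i/Fil^k ⟶ Fil^i/Fil^j` in the heart
comes from a distinguished triangle. -/
lemma exists_distTriang_heartQuot {i j k : EInt} (h : i ≤ j) (h' : j ≤ k)
    (X : (grMemHeart P t).FullSubcategory) :
    ∃ (δ : (heartι P t).obj ((heartQuot P t i j h).obj X) ⟶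
        ((heartι P t).obj ((heartQuot P t j k h').obj X))⟦(1 : ℤ)⟧),
      Triangle.mk ((heartι P t).map ((heartQuotMap t (h.trans h') h' h le_rfl).app X))
        ((heartι P t).map ((heartQuotMap t h (h.trans h') le_rfl h').app X)) δ ∈
          distTriang (DerivedCategory.Plus A) := by
  obtain ⟨δ, hδ⟩ := exists_distTriang_quot h h' X.obj
  let e (i j : EInt) (h : i ≤ j) : (heartι P t).obj ((heartQuot P t i j h).obj X) ≅
    (quot i j h).obj X.obj := (heartQuotIso t i j h).app X
  refine ⟨(e i j h).hom ≫ δ ≫ (shiftFunctor _ (1 : ℤ)).map (e j k h').inv,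
    isomorphic_distinguished _ hδ _ (Triangle.isoMk _ _ (e j k h')
      (e i k (h.trans h')) (e i j h) ?_ ?_ ?_)⟩
  · exact heartQuotMap_app_heartQuotIso t _ _ _ _ X
  · exact heartQuotMap_app_heartQuotIso t _ _ _ _ X
  · change ((e i j h).hom ≫ δ ≫ (shiftFunctor _ (1 : ℤ)).map (e j k h').inv) ≫
      (shiftFunctor _ (1 : ℤ)).map (e j k h').hom = (e i j h).hom ≫ δ
    rw [Category.assoc, Category.assoc, ← Functor.map_comp, Iso.inv_hom_id,
      CategoryTheory.Functor.map_id, Category.comp_id]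

/-- In the heart, `Fil^j/Fil^k` is a subobject of `Fil^i/Fil^k`. -/
instance mono_heartQuotMap_app {i j k : EInt} (h : i ≤ j) (h' : j ≤ k)
    (X : (grMemHeart P t).FullSubcategory) :
    Mono ((heartQuotMap t (h.trans h') h' h le_rfl).app X) := by
  obtain ⟨δ, hδ⟩ := exists_distTriang_heartQuot t h h' X
  exact mono_of_distTriang_heart t hδ

lemma heartQuotMap_app_comp_eq_zero {i j k : EInt} (h : i ≤ j) (h' : j ≤ k)
    (X : (grMemHeart P t).FullSubcategory) :
    (heartQuotMap t (h.trans h') h' h le_rfl).app X ≫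
      (heartQuotMap t h (h.trans h') le_rfl h').app X = 0 := by
  obtain ⟨δ, hδ⟩ := exists_distTriang_heartQuot t h h' X
  exact comp_eq_zero_of_distTriang_heart t hδ

/-- In the heart, `Fil^i/Fil^j` is the cokernel of `Fil^j/Fil^k ⟶ Fil^i/Fil^k`. -/
noncomputable def isColimitHeartQuot {i j k : EInt} (h : i ≤ j) (h' : j ≤ k)
    (X : (grMemHeart P t).FullSubcategory) :
    IsColimit (CokernelCofork.ofπ _ (heartQuotMap_app_comp_eq_zero t h h' X)) :=
  (isColimit_of_distTriang_heart t (exists_distTriang_heartQuot t h h' X).choose_spec).some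

lemma exists_isIso_heartQuotMap_app (X : (grMemHeart P t).FullSubcategory) :
    ∃ a : ℤ, ∀ i : EInt, i ≤ (a : EInt) →
      IsIso ((heartQuotMap t le_top le_top (bot_le : ⊥ ≤ i) le_rfl).app X) := by
  obtain ⟨K, hK⟩ := exists_Q_obj_eq X.obj
  obtain ⟨a, ha⟩ := K.exists_fil_eq_bot
  refine ⟨a, fun i hi => ?_⟩
  have := K.isIso_quotMap_app le_top le_top (bot_le : ⊥ ≤ i) le_rfl
    (le_antisymm (ha.ge.trans (K.antitone_fil hi)) (K.antitone_fil bot_le)) rfl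
  have h₁ : IsIso ((quotMap le_top le_top (bot_le : ⊥ ≤ i) le_rfl).app X.obj) := by
    rw [← hK]
    have h₂ : IsIso ((quotIso i ⊤ le_top K).hom ≫ Q.map
      ((FilteredObject.quotMap le_top le_top (bot_le : ⊥ ≤ i) le_rfl).app K)) := inferInstance
    rw [← quotMap_app_quotIso] at h₂
    exact IsIso.of_isIso_comp_right _ (quotIso ⊥ ⊤ le_top K).hom
  have h₂ : IsIso ((heartι P t).map
      ((heartQuotMap t le_top le_top (bot_le : ⊥ ≤ i) le_rfl).app X)) := by
    have h₃ : IsIso ((heartQuotIso t i ⊤ le_top).hom.app X ≫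
      (quotMap le_top le_top (bot_le : ⊥ ≤ i) le_rfl).app X.obj) := inferInstance
    rw [← heartQuotMap_app_heartQuotIso] at h₃
    exact IsIso.of_isIso_comp_right _ ((heartQuotIso t ⊥ ⊤ le_top).hom.app X)
  exact isIso_of_reflects_iso _ (heartι P t)

lemma exists_isZero_heartQuot_obj (X : (grMemHeart P t).FullSubcategory) :
    ∃ b : ℤ, ∀ i : EInt, (b : EInt) ≤ i → IsZero ((heartQuot P t i ⊤ le_top).obj X) := by
  obtain ⟨K, hK⟩ := exists_Q_obj_eq X.obj
  obtain ⟨b, hb⟩ := K.exists_ge_isZero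
  refine ⟨b, fun i hi => ?_⟩
  have h₁ : IsZero ((quot i ⊤ le_top).obj X.obj) := by
    rw [← hK]
    exact (Q.map_isZero (hb i hi)).of_iso (filIso i K).symm
  have h₂ : IsZero ((heartι P t).obj ((heartQuot P t i ⊤ le_top).obj X)) :=
    h₁.of_iso ((heartQuotIso t i ⊤ le_top).app X)
  rw [IsZero.iff_id_eq_zero]
  exact (heartι P t).map_injective (h₂.eq_of_src _ _)

/-- The filtered object of the heart attached to an object of the filtered derived category
whose graded pieces belong to the heart: the object `Fil^{-∞}/Fil^{+∞}`, with the filtration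
by the subobjects `Fil^i/Fil^{+∞}`. -/
noncomputable abbrev toFilteredObjectObj (X : (grMemHeart P t).FullSubcategory) :
    FilteredObject t.heart.FullSubcategory :=
  FilteredObject.ofMono ((heartQuot P t ⊥ ⊤ le_top).obj X)
    (fun i => (heartQuot P t i ⊤ le_top).obj X)
    (fun _ => (heartQuotMap t le_top le_top bot_le le_rfl).app X)
    (fun _ _ h => ⟨(heartQuotMap t le_top le_top h le_rfl).app X, heartQuotMap_comp ..⟩)
    (exists_isIso_heartQuotMap_app t X) (exists_isZero_heartQuot_obj t X)

/-- The steps of the filtration of `toFilteredObjectObj`. -/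
noncomputable def toFilteredObjectFilIso (X : (grMemHeart P t).FullSubcategory) (i : EInt) :
    ((toFilteredObjectObj t X).fil i : t.heart.FullSubcategory) ≅
      (heartQuot P t i ⊤ le_top).obj X :=
  FilteredObject.ofMonoFilIso _ _ _ _ _ _ i

lemma toFilteredObjectFilIso_hom_comp (X : (grMemHeart P t).FullSubcategory) (i : EInt) :
    (toFilteredObjectFilIso t X i).hom ≫ (heartQuotMap t le_top le_top bot_le le_rfl).app X =
      ((toFilteredObjectObj t X).fil i).arrow :=
  FilteredObject.ofMonoFilIso_hom_comp ..

lemma incl_toFilteredObjectFilIso (X : (grMemHeart P t).FullSubcategory) {i j : EInt}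
    (h : i ≤ j) :
    (toFilteredObjectObj t X).incl h ≫ (toFilteredObjectFilIso t X i).hom =
      (toFilteredObjectFilIso t X j).hom ≫ (heartQuotMap t le_top le_top h le_rfl).app X := by
  rw [← cancel_mono ((heartQuotMap t le_top le_top (bot_le : ⊥ ≤ i) le_rfl).app X),
    Category.assoc, Category.assoc, heartQuotMap_comp, toFilteredObjectFilIso_hom_comp,
    toFilteredObjectFilIso_hom_comp, FilteredObject.incl_arrow]

/-- The functor which sends an object of the filtered derived category
whose graded pieces belong to the heart to the corresponding filtered object of the heart. -/
noncomputable abbrev toFilteredObject :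
    (grMemHeart P t).FullSubcategory ⥤ FilteredObject t.heart.FullSubcategory where
  obj X := toFilteredObjectObj t X
  map {X Y} f := FilteredObject.homMk ((heartQuot P t ⊥ ⊤ le_top).map f)
    (fun i => (toFilteredObjectFilIso t X i).hom ≫ (heartQuot P t i ⊤ le_top).map f ≫
      (toFilteredObjectFilIso t Y i).inv) (fun i => by
      rw [← toFilteredObjectFilIso_hom_comp, ← toFilteredObjectFilIso_hom_comp, Category.assoc,
        Category.assoc, Iso.inv_hom_id_assoc, NatTrans.naturality, Category.assoc])
  map_id X := FilteredObject.hom_ext ((heartQuot P t ⊥ ⊤ le_top).map_id X)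
  map_comp f g := FilteredObject.hom_ext ((heartQuot P t ⊥ ⊤ le_top).map_comp f g)

lemma filMap_toFilteredObject_map {X Y : (grMemHeart P t).FullSubcategory} (f : X ⟶ Y)
    (i : EInt) :
    FilteredObject.filMap ((toFilteredObject t).map f) i ≫ (toFilteredObjectFilIso t Y i).hom =
      (toFilteredObjectFilIso t X i).hom ≫ (heartQuot P t i ⊤ le_top).map f := by
  rw [← cancel_mono ((heartQuotMap t le_top le_top (bot_le : ⊥ ≤ i) le_rfl).app Y),
    Category.assoc, Category.assoc, toFilteredObjectFilIso_hom_comp, NatTrans.naturality]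
  refine (FilteredObject.filMap_arrow _ _).trans ?_
  rw [← Category.assoc, toFilteredObjectFilIso_hom_comp]
  rfl

end FilteredDerivedCategory

/-! ### Compatibility with the functors `Fil^i/Fil^j` -/

namespace FilteredDerivedCategory

variable {A : Type u} [Category.{v} A] [Abelian A] [HasDerivedCategory.{w} A]
  {P : ObjectProperty (DerivedCategory.Plus A)} [P.IsTriangulated]
  (t : Triangulated.TStructure P.FullSubcategory)

open DerivedCategory.Plus

/-- The quotients of the steps of the filtration of `toFilteredObjectObj`. -/
noncomputable def toFilteredObjectQuotIsoApp (i j : EInt) (h : i ≤ j)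
    (X : (grMemHeart P t).FullSubcategory) :
    (FilteredObject.quot i j h).obj (toFilteredObjectObj t X) ≅ (heartQuot P t i j h).obj X :=
  cokernel.mapIso _ _ (toFilteredObjectFilIso t X j) (toFilteredObjectFilIso t X i)
    (incl_toFilteredObjectFilIso t X h) ≪≫
    (cokernelIsCokernel _).coconePointUniqueUpToIso (isColimitHeartQuot t h le_top X)

lemma proj_toFilteredObjectQuotIsoApp (i j : EInt) (h : i ≤ j)
    (X : (grMemHeart P t).FullSubcategory) :
    (toFilteredObjectObj t X).proj h ≫ (toFilteredObjectQuotIsoApp t i j h X).hom =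
      (toFilteredObjectFilIso t X i).hom ≫ (heartQuotMap t h le_top le_rfl le_top).app X := by
  have h₁ : (toFilteredObjectObj t X).proj h ≫ (cokernel.mapIso _ _ (toFilteredObjectFilIso t X j)
      (toFilteredObjectFilIso t X i) (incl_toFilteredObjectFilIso t X h)).hom =
      (toFilteredObjectFilIso t X i).hom ≫ cokernel.π _ := cokernel.π_desc _ _ _
  refine (Category.assoc _ _ _).symm.trans ((congrArg (· ≫ _) h₁).trans ?_)
  refine (Category.assoc _ _ _).trans (congrArg _ ?_)
  exact (cokernelIsCokernel _).comp_coconePointUniqueUpToIso_hom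
    (isColimitHeartQuot t h le_top X) WalkingParallelPair.one

/-- The functors `Fil^i/Fil^j` correspond to each other under the functor `toFilteredObject`. -/
noncomputable def toFilteredObjectQuotIso (i j : EInt) (h : i ≤ j) :
    toFilteredObject t ⋙ FilteredObject.quot i j h ≅ heartQuot P t i j h :=
  NatIso.ofComponents (toFilteredObjectQuotIsoApp t i j h) (fun {X Y} f => by
    rw [← cancel_epi ((toFilteredObjectObj t X).proj h)]
    change (toFilteredObjectObj t X).proj h ≫
      (FilteredObject.quot i j h).map ((toFilteredObject t).map f) ≫ _ = _
    rw [← Category.assoc, FilteredObject.proj_quot_map, Category.assoc,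
      proj_toFilteredObjectQuotIsoApp, ← Category.assoc, filMap_toFilteredObject_map,
      ← Category.assoc, proj_toFilteredObjectQuotIsoApp, Category.assoc, Category.assoc,
      NatTrans.naturality])

lemma quotMap_app_toFilteredObjectQuotIso {i j i' j' : EInt} (h : i ≤ j) (h' : i' ≤ j')
    (hi : i ≤ i') (hj : j ≤ j') (X : (grMemHeart P t).FullSubcategory) :
    (FilteredObject.quotMap h h' hi hj).app ((toFilteredObject t).obj X) ≫
        (toFilteredObjectQuotIso t i j h).hom.app X =
      (toFilteredObjectQuotIso t i' j' h').hom.app X ≫ (heartQuotMap t h h' hi hj).app X := by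
  rw [← cancel_epi ((toFilteredObjectObj t X).proj h')]
  change (toFilteredObjectObj t X).proj h' ≫ (toFilteredObjectObj t X).quotMapApp h h' hi hj ≫
      (toFilteredObjectQuotIsoApp t i j h X).hom = (toFilteredObjectObj t X).proj h' ≫
      (toFilteredObjectQuotIsoApp t i' j' h' X).hom ≫ _
  rw [← Category.assoc, FilteredObject.proj_quotMapApp, Category.assoc,
    proj_toFilteredObjectQuotIsoApp, ← Category.assoc, incl_toFilteredObjectFilIso,
    ← Category.assoc, proj_toFilteredObjectQuotIsoApp, Category.assoc, Category.assoc,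
    heartQuotMap_comp, heartQuotMap_comp]

section

variable {t}

/-- The object of the filtered derived category given by a filtered complex whose
graded pieces belong to the heart. -/
def ofComplex (K : FilteredObject (CochainComplex.Plus A))
    (hK : grMemHeart P t ((quasiIso A).Q.obj K)) : (grMemHeart P t).FullSubcategory :=
  ⟨(quasiIso A).Q.obj K, hK⟩

/-- The morphism in the filtered derived category given by a morphism of filtered complexes. -/
noncomputable def ofComplexHom {K L : FilteredObject (CochainComplex.Plus A)}
    (hK : grMemHeart P t ((quasiIso A).Q.obj K)) (hL : grMemHeart P t ((quasiIso A).Q.obj L))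
    (f : K ⟶ L) : ofComplex K hK ⟶ ofComplex L hL :=
  ObjectProperty.homMk ((quasiIso A).Q.map f)

/-- The steps of the filtration of `K` compute the functors `Fil^i/Fil^{+∞}`. -/
noncomputable def ofComplexFilIso (K : FilteredObject (CochainComplex.Plus A))
    (hK : grMemHeart P t ((quasiIso A).Q.obj K)) (i : EInt) :
    Q.obj (K.fil i : CochainComplex.Plus A) ≅
      ((grMemHeart P t).ι ⋙ quot i ⊤ le_top).obj (ofComplex K hK) :=
  filIso i K

lemma filMap_ofComplexFilIso {K L : FilteredObject (CochainComplex.Plus A)} (f : K ⟶ L)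
    (hK : grMemHeart P t ((quasiIso A).Q.obj K)) (hL : grMemHeart P t ((quasiIso A).Q.obj L))
    (i : EInt) :
    Q.map (FilteredObject.filMap f i) ≫ (ofComplexFilIso L hL i).hom =
      (ofComplexFilIso K hK i).hom ≫
        ((grMemHeart P t).ι ⋙ quot i ⊤ le_top).map (ofComplexHom hK hL f) :=
  filIso_naturality i f

lemma incl_ofComplexFilIso (K : FilteredObject (CochainComplex.Plus A))
    (hK : grMemHeart P t ((quasiIso A).Q.obj K)) {i j : EInt} (h : i ≤ j) :
    Q.map (K.incl h) ≫ (ofComplexFilIso K hK i).hom =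
      (ofComplexFilIso K hK j).hom ≫
        (quotMap le_top le_top h le_rfl).app (ofComplex K hK).obj :=
  incl_filIso h K

/-- For a filtered complex `K` whose graded pieces belong to the heart, the steps of the
filtration of `K` and of the corresponding filtered object of the heart are isomorphic. -/
noncomputable def filHeartIso (K : FilteredObject (CochainComplex.Plus A))
    (hK : grMemHeart P t ((quasiIso A).Q.obj K)) (i : EInt) :
    Q.obj (K.fil i : CochainComplex.Plus A) ≅
      (heartι P t).obj ((toFilteredObjectObj t (ofComplex K hK)).fil i : t.heart.FullSubcategory) :=
  ofComplexFilIso K hK i ≪≫ ((heartQuotIso t i ⊤ le_top).app (ofComplex K hK)).symm ≪≫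
    (heartι P t).mapIso (toFilteredObjectFilIso t (ofComplex K hK) i).symm

lemma filHeartIso_hom_comp (K : FilteredObject (CochainComplex.Plus A))
    (hK : grMemHeart P t ((quasiIso A).Q.obj K)) (i : EInt) :
    (filHeartIso K hK i).hom ≫ (heartι P t).map (toFilteredObjectFilIso t (ofComplex K hK) i).hom ≫
      (heartQuotIso t i ⊤ le_top).hom.app (ofComplex K hK) = (ofComplexFilIso K hK i).hom := by
  have h₁ : (heartι P t).map (toFilteredObjectFilIso t (ofComplex K hK) i).inv ≫
      (heartι P t).map (toFilteredObjectFilIso t (ofComplex K hK) i).hom ≫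
      (heartQuotIso t i ⊤ le_top).hom.app (ofComplex K hK) =
      (heartQuotIso t i ⊤ le_top).hom.app (ofComplex K hK) := by
    rw [← Category.assoc, ← Functor.map_comp, Iso.inv_hom_id, CategoryTheory.Functor.map_id]
    exact Category.id_comp _
  change ((ofComplexFilIso K hK i).hom ≫ (heartQuotIso t i ⊤ le_top).inv.app (ofComplex K hK) ≫
    (heartι P t).map (toFilteredObjectFilIso t (ofComplex K hK) i).inv) ≫ _ = _
  rw [Category.assoc, Category.assoc, h₁, Iso.inv_hom_id_app]
  exact Category.comp_id _

lemma incl_filHeartIso (K : FilteredObject (CochainComplex.Plus A))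
    (hK : grMemHeart P t ((quasiIso A).Q.obj K)) {i j : EInt} (h : i ≤ j) :
    Q.map (K.incl h) ≫ (filHeartIso K hK i).hom =
      (filHeartIso K hK j).hom ≫
        (heartι P t).map ((toFilteredObjectObj t (ofComplex K hK)).incl h) := by
  rw [← cancel_mono ((heartι P t).map (toFilteredObjectFilIso t (ofComplex K hK) i).hom),
    ← cancel_mono ((heartQuotIso t i ⊤ le_top).hom.app (ofComplex K hK))]
  rw [Category.assoc, Category.assoc, Category.assoc, Category.assoc, filHeartIso_hom_comp,
    incl_ofComplexFilIso, ← filHeartIso_hom_comp K hK j, Category.assoc, Category.assoc]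
  congr 1
  rw [← Category.assoc ((heartι P t).map (FilteredObject.incl _ _)), ← Functor.map_comp,
    incl_toFilteredObjectFilIso, Functor.map_comp, Category.assoc]
  congr 1
  exact (heartQuotMap_app_heartQuotIso t _ _ _ _ _).symm

lemma filMap_filHeartIso {K L : FilteredObject (CochainComplex.Plus A)} (f : K ⟶ L)
    (hK : grMemHeart P t ((quasiIso A).Q.obj K)) (hL : grMemHeart P t ((quasiIso A).Q.obj L))
    (i : EInt) :
    Q.map (FilteredObject.filMap f i) ≫ (filHeartIso L hL i).hom =
      (filHeartIso K hK i).hom ≫ (heartι P t).map (FilteredObject.filMap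
        ((toFilteredObject t).map (ofComplexHom hK hL f)) i) := by
  rw [← cancel_mono ((heartι P t).map (toFilteredObjectFilIso t (ofComplex L hL) i).hom),
    ← cancel_mono ((heartQuotIso t i ⊤ le_top).hom.app (ofComplex L hL))]
  rw [Category.assoc, Category.assoc, Category.assoc, Category.assoc, filHeartIso_hom_comp,
    filMap_ofComplexFilIso f hK hL, ← filHeartIso_hom_comp K hK i, Category.assoc,
    Category.assoc]
  congr 1
  rw [← Category.assoc ((heartι P t).map (FilteredObject.filMap _ _)), ← Functor.map_comp,
    filMap_toFilteredObject_map, Functor.map_comp, Category.assoc]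
  congr 1
  exact (heartQuot_map_heartQuotIso t i ⊤ le_top (ofComplexHom hK hL f)).symm

end

end FilteredDerivedCategory

/-! ### Full faithfulness and essential surjectivity -/

namespace FilteredDerivedCategory

variable {A : Type u} [Category.{v} A] [Abelian A] [HasDerivedCategory.{w} A]
  {P : ObjectProperty (DerivedCategory.Plus A)} [P.IsTriangulated]
  {t : Triangulated.TStructure P.FullSubcategory}

open DerivedCategory.Plus

/-- If the steps of the filtration of a filtered complex are represented by those of
a filtered object of the heart, then the graded pieces belong to the heart. -/
lemma grMemHeart_of_iso (K : FilteredObject (CochainComplex.Plus A))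
    (X : FilteredObject t.heart.FullSubcategory)
    (ε : ∀ i, Q.obj (K.fil i : CochainComplex.Plus A) ≅
      (heartι P t).obj (X.fil i : t.heart.FullSubcategory))
    (hε : ∀ i j (h : i ≤ j), Q.map (K.incl h) ≫ (ε i).hom =
      (ε j).hom ≫ (heartι P t).map (X.incl h)) :
    grMemHeart P t ((quasiIso A).Q.obj K) := by
  have key (i : ℤ) : (heartι P t).essImage ((gr i).obj ((quasiIso A).Q.obj K)) := by
    have h : (i : EInt) ≤ ((i + 1 : ℤ) : EInt) := WithBotTop.coe_le_coe.2 (by lia)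
    obtain ⟨δ, hδ⟩ := exists_distTriang_quot h le_top ((quasiIso A).Q.obj K)
    refine essImage_heart_of_mono t (X.incl h) hδ ((filIso _ K).symm ≪≫ ε _)
      ((filIso _ K).symm ≪≫ ε _) ?_
    change (quotMap _ _ _ _).app _ ≫ (filIso _ K).inv ≫ (ε _).hom =
      ((filIso _ K).inv ≫ (ε _).hom) ≫ _
    rw [← cancel_epi (filIso _ K).hom, ← Category.assoc, ← incl_filIso, Category.assoc,
      Iso.hom_inv_id_assoc, Category.assoc, Iso.hom_inv_id_assoc, hε]
  refine ⟨fun i => ?_, key⟩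
  obtain ⟨X, ⟨e⟩⟩ := key i
  exact ⟨_, X.obj.property, ⟨e.symm⟩⟩

lemma exists_ofComplex_eq (X : (grMemHeart P t).FullSubcategory) :
    ∃ (K : FilteredObject (CochainComplex.Plus A))
      (hK : grMemHeart P t ((quasiIso A).Q.obj K)), ofComplex K hK = X := by
  obtain ⟨X, hX⟩ := X
  obtain ⟨K, rfl⟩ := exists_Q_obj_eq X
  exact ⟨K, hX, rfl⟩

lemma exists_ofComplexHom_eq {K I : FilteredObject (CochainComplex.Plus A)} (hI : I.IsInjective)
    {hK : grMemHeart P t ((quasiIso A).Q.obj K)} {hI' : grMemHeart P t ((quasiIso A).Q.obj I)}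
    (f : ofComplex K hK ⟶ ofComplex I hI') : ∃ g : K ⟶ I, ofComplexHom hK hI' g = f := by
  obtain ⟨g, hg⟩ := FilteredObject.exists_Q_map_eq hI f.hom
  exact ⟨g, InducedCategory.hom_ext hg⟩

/-- On morphisms to a filtered injective complex, the functor `toFilteredObject` is faithful: as
there are no nonzero morphisms `X[1] ⟶ Y` in the heart, morphisms are
determined by their effect on the steps of the filtrations. -/
lemma toFilteredObject_map_injective {K I : FilteredObject (CochainComplex.Plus A)}
    (hI : I.IsInjective)
    {hK : grMemHeart P t ((quasiIso A).Q.obj K)} {hI' : grMemHeart P t ((quasiIso A).Q.obj I)}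
    (f g : ofComplex K hK ⟶ ofComplex I hI')
    (h : (toFilteredObject t).map f = (toFilteredObject t).map g) : f = g := by
  obtain ⟨f, rfl⟩ := exists_ofComplexHom_eq hI f
  obtain ⟨g, rfl⟩ := exists_ofComplexHom_eq hI g
  have hfg : (quasiIso A).Q.map f = (quasiIso A).Q.map g := by
    refine FilteredObject.Q_map_eq_of_Q_map_filMap_eq hI (fun i β => ?_) f g (fun i => ?_)
    · exact essImage_heart_shift_hom_eq_zero t ⟨_, ⟨(filHeartIso K hK _).symm⟩⟩
        ⟨_, ⟨(filHeartIso I hI' _).symm⟩⟩ β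
    · rw [← cancel_mono (filHeartIso I hI' i).hom, filMap_filHeartIso f hK hI',
        filMap_filHeartIso g hK hI']
      exact congrArg (fun a => (filHeartIso K hK i).hom ≫
        (heartι P t).map (FilteredObject.filMap a i)) h
  exact InducedCategory.hom_ext hfg

/-- On morphisms to a filtered injective complex, the functor `toFilteredObject` is full: the
morphisms induced on the steps of the filtrations are compatible, so that they lift to
a morphism of filtered complexes. -/
lemma toFilteredObject_map_surjective {K I : FilteredObject (CochainComplex.Plus A)}
    (hI : I.IsInjective)
    (hK : grMemHeart P t ((quasiIso A).Q.obj K)) (hI' : grMemHeart P t ((quasiIso A).Q.obj I))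
    (a : (toFilteredObject t).obj (ofComplex K hK) ⟶ (toFilteredObject t).obj (ofComplex I hI')) :
    ∃ f : ofComplex K hK ⟶ ofComplex I hI', (toFilteredObject t).map f = a := by
  obtain ⟨f, hf⟩ := FilteredObject.exists_hom_of_compatible hI (Z := K)
    (fun i => (filHeartIso K hK i).hom ≫ (heartι P t).map (FilteredObject.filMap a i) ≫
      (filHeartIso I hI' i).inv) (fun i j h => by
      rw [← cancel_mono (filHeartIso I hI' i).hom, Category.assoc, incl_filHeartIso,
        Category.assoc, Category.assoc, Iso.inv_hom_id_assoc, ← Functor.map_comp,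
        ← FilteredObject.incl_filMap, Functor.map_comp, ← Category.assoc, ← incl_filHeartIso,
        Category.assoc, Category.assoc, Category.assoc, Category.assoc, Iso.inv_hom_id,
        Category.comp_id])
  refine ⟨ofComplexHom hK hI' f,
    FilteredObject.hom_ext_filMap ((heartι P t).map_injective ?_)⟩
  rw [← cancel_epi (filHeartIso K hK ⊥).hom]
  refine (filMap_filHeartIso f hK hI' ⊥).symm.trans ?_
  rw [hf, Category.assoc, Category.assoc, Iso.inv_hom_id, Category.comp_id]

variable [EnoughInjectives A]

variable (t) in
/-- Any object of the filtered derived category whose graded pieces belong to the heart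
is represented by a filtered injective complex. -/
lemma exists_iso_ofComplex (X : (grMemHeart P t).FullSubcategory) :
    ∃ (I : FilteredObject (CochainComplex.Plus A)) (_ : I.IsInjective)
      (hI : grMemHeart P t ((quasiIso A).Q.obj I)), Nonempty (X ≅ ofComplex I hI) := by
  obtain ⟨K, hK, rfl⟩ := exists_ofComplex_eq X
  obtain ⟨I, hI, ε, hε⟩ := FilteredObject.exists_isInjective (heartι P t)
    (toFilteredObjectObj t (ofComplex K hK))
  -- the identity of the filtered object in the heart lifts to a morphism of filtered complexes
  obtain ⟨f, hf⟩ := FilteredObject.exists_hom_of_compatible hI (Z := K)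
    (fun i => (filHeartIso K hK i).hom ≫ (ε i).inv) (fun i j h => by
      rw [← cancel_mono (ε i).hom, Category.assoc, hε, Category.assoc, Iso.inv_hom_id_assoc,
        ← incl_filHeartIso, Category.assoc, Category.assoc, Iso.inv_hom_id, Category.comp_id])
  have hf' : quasiIso A f := by
    rw [FilteredObject.quasiIso_iff_isIso_Q_map_filMap]
    intro i
    rw [hf]
    infer_instance
  let e := Localization.isoOfHom (quasiIso A).Q (quasiIso A) f hf'
  exact ⟨I, hI, grMemHeart_of_iso I _ ε hε, ⟨ObjectProperty.isoMk _ e⟩⟩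

instance : (toFilteredObject t).Faithful where
  map_injective {X Y f g} h := by
    obtain ⟨I, hI, hI', ⟨e⟩⟩ := exists_iso_ofComplex t Y
    obtain ⟨K, hK, rfl⟩ := exists_ofComplex_eq X
    rw [← cancel_mono e.hom]
    exact toFilteredObject_map_injective hI _ _ (by
      rw [Functor.map_comp, h, Functor.map_comp])

instance : (toFilteredObject t).Full where
  map_surjective {X Y} a := by
    obtain ⟨I, hI, hI', ⟨e⟩⟩ := exists_iso_ofComplex t Y
    obtain ⟨K, hK, rfl⟩ := exists_ofComplex_eq X
    obtain ⟨f, hf⟩ := toFilteredObject_map_surjective hI hK hI'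
      (a ≫ (toFilteredObject t).map e.hom)
    refine ⟨f ≫ e.inv, ?_⟩
    rw [Functor.map_comp, hf, Category.assoc, ← Functor.map_comp, e.hom_inv_id,
      CategoryTheory.Functor.map_id, Category.comp_id]

instance : (toFilteredObject t).EssSurj where
  mem_essImage X := by
    obtain ⟨I, hI, ε, hε⟩ := FilteredObject.exists_isInjective (heartι P t) X
    have hI' := grMemHeart_of_iso I X ε hε
    let κ (i : EInt) := (heartι P t).preimageIso ((filHeartIso I hI' i).symm ≪≫ ε i)
    obtain ⟨f, hf⟩ := FilteredObject.exists_filMap_eq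
      (X := (toFilteredObject t).obj (ofComplex I hI')) (Y := X) (fun i => (κ i).hom)
      (fun i j h => (heartι P t).map_injective (by
        rw [Functor.map_comp, Functor.map_comp, Functor.preimageIso_hom, Functor.preimageIso_hom,
          Functor.map_preimage, Functor.map_preimage, ← cancel_epi (filHeartIso I hI' j).hom,
          ← Category.assoc, ← incl_filHeartIso]
        simp [hε]))
    have : IsIso f := FilteredObject.isIso_of_isIso_filMap f (fun i => by
      rw [hf]
      infer_instance)
    exact ⟨_, ⟨asIso f⟩⟩

instance : (toFilteredObject t).IsEquivalence where

end FilteredDerivedCategory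

/-! ### The equivalence of categories -/

namespace FilteredDerivedCategory

variable {A : Type u} [Category.{v} A] [Abelian A] [HasDerivedCategory.{w} A]

instance : IsIso (omegaToQuot (A := A)) := by
  have (X : Plus A) : IsIso ((omegaToQuot (A := A)).app X) := by
    obtain ⟨K, rfl⟩ := exists_Q_obj_eq X
    rw [omegaToQuot, Localization.liftNatTrans_app]
    infer_instance
  exact NatIso.isIso_of_isIso_app _

variable {P : ObjectProperty (DerivedCategory.Plus A)} [P.IsTriangulated]
  (t : Triangulated.TStructure P.FullSubcategory)

/-- The functors `Fil^i/Fil^j` on filtered objects of the heart and on the filtered derived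
category correspond to each other under the functor `toFilteredObject`. -/
noncomputable def toFilteredObjectCompQuotIso (i j : EInt) (h : i ≤ j) :
    toFilteredObject t ⋙ FilteredObject.quot i j h ⋙ heartι P t ≅
      (grMemHeart P t).ι ⋙ quot i j h :=
  Functor.isoWhiskerRight (toFilteredObjectQuotIso t i j h) (heartι P t) ≪≫ heartQuotIso t i j h

lemma quotMap_app_toFilteredObjectCompQuotIso {i j i' j' : EInt} (h : i ≤ j) (h' : i' ≤ j')
    (hi : i ≤ i') (hj : j ≤ j') (X : (grMemHeart P t).FullSubcategory) :
    (heartι P t).map ((FilteredObject.quotMap h h' hi hj).app ((toFilteredObject t).obj X)) ≫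
        (toFilteredObjectCompQuotIso t i j h).hom.app X =
      (toFilteredObjectCompQuotIso t i' j' h').hom.app X ≫ (quotMap h h' hi hj).app X.obj := by
  change (heartι P t).map _ ≫ (heartι P t).map ((toFilteredObjectQuotIso t i j h).hom.app X) ≫
    (heartQuotIso t i j h).hom.app X =
    ((heartι P t).map ((toFilteredObjectQuotIso t i' j' h').hom.app X) ≫
      (heartQuotIso t i' j' h').hom.app X) ≫ _
  rw [Category.assoc, ← heartQuotMap_app_heartQuotIso, ← Category.assoc, ← Category.assoc,
    ← Functor.map_comp, ← Functor.map_comp, quotMap_app_toFilteredObjectQuotIso]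

variable [EnoughInjectives A]

/-- The equivalence between filtered objects of the heart and objects of the filtered
derived category whose graded pieces belong to the heart. -/
noncomputable def filteredHeartEquivalence :
    FilteredObject t.heart.FullSubcategory ≌ (grMemHeart P t).FullSubcategory :=
  (toFilteredObject t).asEquivalence.symm

/-- The functors `Fil^i/Fil^j` correspond to each other under `filteredHeartEquivalence`. -/
noncomputable def filteredHeartEquivalenceQuotIso (i j : EInt) (h : i ≤ j) :
    (filteredHeartEquivalence t).functor ⋙ (grMemHeart P t).ι ⋙ quot i j h ≅
      FilteredObject.quot i j h ⋙ heartι P t :=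
  Functor.isoWhiskerLeft _ (toFilteredObjectCompQuotIso t i j h).symm ≪≫
    Functor.isoWhiskerRight (filteredHeartEquivalence t).unitIso.symm
      (FilteredObject.quot i j h ⋙ heartι P t)

lemma quotMap_app_filteredHeartEquivalenceQuotIso {i j i' j' : EInt} (h : i ≤ j) (h' : i' ≤ j')
    (hi : i ≤ i') (hj : j ≤ j') (X : FilteredObject t.heart.FullSubcategory) :
    (quotMap h h' hi hj).app ((filteredHeartEquivalence t).functor.obj X).obj ≫
        (filteredHeartEquivalenceQuotIso t i j h).hom.app X =
      (filteredHeartEquivalenceQuotIso t i' j' h').hom.app X ≫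
        (heartι P t).map ((FilteredObject.quotMap h h' hi hj).app X) := by
  set Y := (filteredHeartEquivalence t).functor.obj X
  let η : (toFilteredObject t).obj Y ⟶ X := (filteredHeartEquivalence t).unitIso.inv.app X
  change _ ≫ (toFilteredObjectCompQuotIso t i j h).inv.app Y ≫
      (heartι P t).map ((FilteredObject.quot i j h).map η) =
    ((toFilteredObjectCompQuotIso t i' j' h').inv.app Y ≫
      (heartι P t).map ((FilteredObject.quot i' j' h').map η)) ≫ _
  rw [← cancel_epi ((toFilteredObjectCompQuotIso t i' j' h').hom.app Y), ← Category.assoc,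
    ← quotMap_app_toFilteredObjectCompQuotIso, Category.assoc, Category.assoc,
    Iso.hom_inv_id_app_assoc, Iso.hom_inv_id_app_assoc, ← Functor.map_comp, ← Functor.map_comp,
    NatTrans.naturality]

/-- The forgetful functors correspond to each other under `filteredHeartEquivalence`. -/
noncomputable def filteredHeartEquivalenceOmegaIso :
    (filteredHeartEquivalence t).functor ⋙ (grMemHeart P t).ι ⋙ omega A ≅
      FilteredObject.forget _ ⋙ heartι P t :=
  Functor.isoWhiskerLeft _ (Functor.isoWhiskerLeft _ (asIso omegaToQuot)) ≪≫
    filteredHeartEquivalenceQuotIso t ⊥ ⊤ bot_le ≪≫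
    (Functor.isoWhiskerRight (asIso FilteredObject.toQuot) (heartι P t)).symm

lemma omegaToQuot_app_filteredHeartEquivalenceQuotIso
    (X : FilteredObject t.heart.FullSubcategory) :
    omegaToQuot.app ((filteredHeartEquivalence t).functor.obj X).obj ≫
        (filteredHeartEquivalenceQuotIso t ⊥ ⊤ bot_le).hom.app X =
      (filteredHeartEquivalenceOmegaIso t).hom.app X ≫
        (heartι P t).map (FilteredObject.toQuot.app X) := by
  have e : (filteredHeartEquivalenceOmegaIso t).hom ≫
      (Functor.isoWhiskerRight (asIso FilteredObject.toQuot) (heartι P t)).hom =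
      Functor.whiskerLeft (filteredHeartEquivalence t).functor
        (Functor.whiskerLeft (grMemHeart P t).ι omegaToQuot) ≫
        (filteredHeartEquivalenceQuotIso t ⊥ ⊤ bot_le).hom := by
    rw [filteredHeartEquivalenceOmegaIso, Iso.trans_hom, Iso.trans_hom, Iso.symm_hom,
      Category.assoc, Category.assoc, Iso.inv_hom_id, Category.comp_id]
    rfl
  exact (congr_app e X).symm

end FilteredDerivedCategory

theorem proposition3p1 {A : Type u} [Category.{v} A] [Abelian A] [EnoughInjectives A]
    [HasDerivedCategory.{w} A]
    (P : ObjectProperty (DerivedCategory.Plus A)) [P.IsTriangulated]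
    (t : Triangulated.TStructure P.FullSubcategory) :
    ∃ (e : FilteredObject t.heart.FullSubcategory ≌
          (FilteredDerivedCategory.grMemHeart P t).FullSubcategory)
      (φ : ∀ (i j : EInt) (h : i ≤ j),
        e.functor ⋙ (FilteredDerivedCategory.grMemHeart P t).ι ⋙
            FilteredDerivedCategory.quot i j h ≅
          FilteredObject.quot i j h ⋙ FilteredDerivedCategory.heartι P t)
      (ψ : e.functor ⋙ (FilteredDerivedCategory.grMemHeart P t).ι ⋙
            FilteredDerivedCategory.omega A ≅
          FilteredObject.forget _ ⋙ FilteredDerivedCategory.heartι P t),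
      (∀ (i j i' j' : EInt) (h : i ≤ j) (h' : i' ≤ j') (hi : i ≤ i') (hj : j ≤ j')
          (X : FilteredObject t.heart.FullSubcategory),
        (FilteredDerivedCategory.quotMap h h' hi hj).app (e.functor.obj X).obj ≫
            (φ i j h).hom.app X =
          (φ i' j' h').hom.app X ≫
            (FilteredDerivedCategory.heartι P t).map
              ((FilteredObject.quotMap h h' hi hj).app X)) ∧
      (∀ X : FilteredObject t.heart.FullSubcategory,
        FilteredDerivedCategory.omegaToQuot.app (e.functor.obj X).obj ≫
            (φ ⊥ ⊤ bot_le).hom.app X =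
          ψ.hom.app X ≫
            (FilteredDerivedCategory.heartι P t).map (FilteredObject.toQuot.app X)) :=
  ⟨FilteredDerivedCategory.filteredHeartEquivalence t,
    FilteredDerivedCategory.filteredHeartEquivalenceQuotIso t,
    FilteredDerivedCategory.filteredHeartEquivalenceOmegaIso t,
    fun _ _ _ _ h h' hi hj =>
      FilteredDerivedCategory.quotMap_app_filteredHeartEquivalenceQuotIso t h h' hi hj,
    FilteredDerivedCategory.omegaToQuot_app_filteredHeartEquivalenceQuotIso t⟩
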